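/- Fix $\beta,m,\delta_*>0$ and $\theta\in(0,1)$. For $k,k'\ge 0$, $c\in[-1,1]$ put $r=\sqrt{k^2+k'^2-2kk'c}$, $v=r/m$, $\Delta=k'-k$, and $$\mathcal B_\beta(k,k')=\sqrt\beta\,e^{\beta\frac{k+k'}2}\int_{-1}^1\frac{1+c^2}{r}\exp\Big(-\beta\,\frac{\Delta^2+\frac{m^2v^4}{4}}{2mv^2}\Big)\,dc .$$ For $\rho>0$ let $D(\theta,\rho)\subset[0,\infty)^2$ be the set of $(k,k')$ such that $|k-k'|\le\rho\sqrt{kk'(k+k')}$ if $(k,k')\in[0,\delta_*]^2$, and $\theta k\le k'\le\theta^{-1}k$ otherwise; let $D=D(\theta,\rho_*)$ with $\rho_*=\frac{1-\theta}{\sqrt{\delta_*\theta(1+\theta)}}$ (the value making the boundary curves continuous), and $\gamma_1(x)=\min\{y:(x,y)\in D\}$. Let $\Phi:[0,\infty)^2\to[0,1]$ be symmetric, continuous on $[0,\infty)^2\setminus\{(0,0)\}$, with $\operatorname{supp}\Phi=D$, and $\Phi=1$ on $D(\theta_1,\rho_1)\subset D$ for some $\theta_1\in(\theta,1)$, $\rho_1>0$.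 Set $$R(k,k')=\big(e^{-\beta k}-e^{-\beta k'}\big)\frac{\mathcal B_\beta(k,k')\Phi(k,k')}{kk'}$$ (taken to be $0$ on the axes). Let $\mathscr M_+([0,\infty))$ be the space of finite nonnegative Borel measures on $[0,\infty)$ with the narrow topology, and $X_\eta(v)=\int_{[0,\infty)}e^{\eta k}\,dv(k)$. Let $v_0\in\mathscr M_+([0,\infty))$ satisfy $X_\eta(v_0)<\infty$ for some $\eta\ge(1-\theta)/2$, and let $v\in C([0,\infty),\mathscr M_+([0,\infty)))$ be a weak solution of $$\frac{\partial v}{\partial t}(t,k)=v(t,k)\int_{[0,\infty)}R(k,k')\,v(t,k')\,dk'$$ with $v(0)=v_0$: for every $\varphi\in C^1_b([0,\infty))$ with $\varphi'(0)=0$, the function $t\mapsto\int\varphi\,dv(t)$ belongs to $W^{1,\infty}_{loc}([0,\infty))$ and, for a.e. $t>0$, $$\frac{d}{dt}\int_{[0,\infty)}\varphi\,dv(t)=\frac12\iint_{[0,\infty)^2}R(k,k')\big(\varphi(k)-\varphi(k')\big)\,dv(t)(k)\,dv(t)(k'),$$ the double integral being absolutely convergent. Assume also $v(t)([0,\infty))=v_0([0,\infty))$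 and $X_\eta(v(t))\le X_\eta(v_0)$ for all $t\ge0$. Define the blocks of $v_0$ as follows. Remove from $[0,\infty)$ every bounded connected component $I$ of $[0,\infty)\setminus\operatorname{supp}v_0$ such that $\inf I\le\gamma_1(\sup I)$. The blocks $A_n(v_0)$ are the intersections with $\operatorname{supp}v_0$ of the connected components of the remaining set. **Theorem.** There are a countable (possibly finite or empty) set $S\subset\operatorname{supp}v_0$ and masses $M'_k>0$, $k\in S$, such that the measure $\mu=\sum_{k\in S}M'_k\,\delta_k$ is finite and, as $s\to\infty$, $v(s+\cdot)$ converges in $C([0,\infty),\mathscr M_+([0,\infty)))$ (uniformly on compact time intervals) to the constant map $\mu$; in particular $v(s)\to\mu$ narrowly. Moreover: 1. $\Phi(k,k')=0$ for all $k\ne k'$ in $S$; 2. $\sum_{k\in S\cap A_n(v_0)}M'_k=v_0(A_n(v_0))$ for every block $A_n(v_0)$; 3. if a block has a minimum $k_n=\min A_n(v_0)>0$, then $k_n\in S$. -/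

import Mathlib

open MeasureTheory Set Filter Topology
open scoped NNReal ENNReal

namespace Compton

noncomputable section

/-! ### The truncated kernel -/

/-- Momentum transfer `|𝐤' - 𝐤|` of two vectors of `ℝ³` of lengths `k`, `k'`, where `c` is the
cosine of the angle between them. -/
def momentumTransfer (k k' c : ℝ) : ℝ := Real.sqrt (k ^ 2 + k' ^ 2 - 2 * k * k' * c)

/-- The redistribution function `𝓑_β(k, k')` for electrons of mass `m`; the angular integral is
written in the variable `c = cos θ ∈ [-1, 1]`, with `v = |𝐤' - 𝐤| / m` and `Δ = k' - k`. -/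
def redistribution (β m k k' : ℝ) : ℝ :=
  Real.sqrt β * Real.exp (β * (k' + k) / 2) *
    ∫ c in (-1 : ℝ)..1,
      (1 + c ^ 2) / momentumTransfer k k' c *
        Real.exp (-β * (((k' - k) ^ 2 + m ^ 2 * (momentumTransfer k k' c / m) ^ 4 / 4) /
          (2 * m * (momentumTransfer k k' c / m) ^ 2)))

/-- The region of pairs `(k, k')` with `|k - k'| ≤ ρ √(k k' (k + k'))` inside the square `[0, δ]²`
and `θ k ≤ k' ≤ θ⁻¹ k` outside it. -/
def region (θ δ ρ : ℝ) : Set (ℝ≥0 × ℝ≥0) :=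
  {p | (((p.1 : ℝ) ≤ δ ∧ (p.2 : ℝ) ≤ δ) →
          |(p.1 : ℝ) - p.2| ≤ ρ * Real.sqrt (p.1 * p.2 * (p.1 + p.2))) ∧
       (¬ ((p.1 : ℝ) ≤ δ ∧ (p.2 : ℝ) ≤ δ) →
          θ * (p.1 : ℝ) ≤ p.2 ∧ (p.2 : ℝ) ≤ θ⁻¹ * p.1)}

/-- The value of `ρ_*` for which the boundary curves of the region are continuous. -/
def rhoStar (θ δ : ℝ) : ℝ := (1 - θ) / Real.sqrt (δ * θ * (1 + θ))

/-- The interaction region `D`. -/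
def interactionRegion (θ δ : ℝ) : Set (ℝ≥0 × ℝ≥0) := region θ δ (rhoStar θ δ)

/-- `Φ` is a cut-off function with parameters `θ` and `δ`: symmetric, with values in `[0, 1]`,
continuous away from the origin, with support exactly `D`, and equal to `1` on a smaller region of
the same shape around the diagonal. -/
structure IsCutoff (θ δ : ℝ) (Φ : ℝ≥0 → ℝ≥0 → ℝ) : Prop where
  nonneg : ∀ k k', 0 ≤ Φ k k'
  le_one : ∀ k k', Φ k k' ≤ 1
  symm : ∀ k k', Φ k k' = Φ k' k
  continuousOn : ContinuousOn (fun p : ℝ≥0 × ℝ≥0 => Φ p.1 p.2) {(0, 0)}ᶜ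
  support_eq : tsupport (fun p : ℝ≥0 × ℝ≥0 => Φ p.1 p.2) = interactionRegion θ δ
  eq_one : ∃ θ₁ ρ₁ : ℝ, θ < θ₁ ∧ θ₁ < 1 ∧ 0 < ρ₁ ∧
    region θ₁ δ ρ₁ ⊆ interactionRegion θ δ ∧ ∀ p ∈ region θ₁ δ ρ₁, Φ p.1 p.2 = 1

/-- `R(k, k') = (e^{-βk} - e^{-βk'}) 𝓑_β(k, k') Φ(k, k') / (k k')`. On the axes `Φ` vanishes off the
origin, and at the origin the first factor vanishes, so the value there is `0`. -/
def rate (β m : ℝ) (Φ : ℝ≥0 → ℝ≥0 → ℝ) (k k' : ℝ≥0) : ℝ :=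
  (Real.exp (-β * k) - Real.exp (-β * k')) *
    (redistribution β m k k' * Φ k k' / ((k : ℝ) * k'))

/-! ### Weak solutions -/

/-- `φ ∈ C¹_b([0, ∞))` with `φ'(0) = 0`; only the values of `φ` on `[0, ∞)` matter. -/
structure IsTest (φ : ℝ → ℝ) : Prop where
  contDiffOn : ContDiffOn ℝ 1 φ (Ici 0)
  bounded : ∃ C, ∀ x ∈ Ici (0 : ℝ), |φ x| ≤ C
  deriv_bounded : ∃ C, ∀ x ∈ Ici (0 : ℝ), |derivWithin φ (Ici 0) x| ≤ C
  deriv_zero : derivWithin φ (Ici 0) 0 = 0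

/-- The exponential moment `X_η(v) = ∫ e^{ηk} dv(k)`. -/
def expMoment (η : ℝ) (v : FiniteMeasure ℝ≥0) : ℝ≥0∞ :=
  ∫⁻ k : ℝ≥0, ENNReal.ofReal (Real.exp (η * k)) ∂(v : Measure ℝ≥0)

/-- `v` is a weak solution of the simplified equation
`∂v/∂t (t, k) = v(t, k) ∫ R(k, k') v(t, k') dk'` with initial datum `v₀`.
`FiniteMeasure ℝ≥0` is the space of finite nonnegative measures on `[0, ∞)` with the narrow
topology, so that an element of `C(ℝ≥0, FiniteMeasure ℝ≥0)` is a map `t ↦ v(t)` for which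
`t ↦ ∫ φ dv(t)` is continuous for all bounded continuous `φ`. Local `W^{1,∞}` regularity of the
continuous function `t ↦ ∫ φ dv(t)` on `[0, ∞)` is Lipschitz continuity on each `[0, T]`. -/
structure IsWeakSolution (β m : ℝ) (Φ : ℝ≥0 → ℝ≥0 → ℝ)
    (v₀ : FiniteMeasure ℝ≥0) (v : C(ℝ≥0, FiniteMeasure ℝ≥0)) : Prop where
  initial : v 0 = v₀
  lipschitz : ∀ φ : ℝ → ℝ, IsTest φ → ∀ T : ℝ≥0, ∃ L : ℝ≥0,
    LipschitzOnWith L (fun t : ℝ≥0 => ∫ k : ℝ≥0, φ k ∂(v t : Measure ℝ≥0)) (Iic T)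
  weak : ∀ φ : ℝ → ℝ, IsTest φ → ∀ᵐ t : ℝ ∂(volume.restrict (Ioi 0)),
    Integrable (fun p : ℝ≥0 × ℝ≥0 => rate β m Φ p.1 p.2 * (φ p.1 - φ p.2))
      ((v t.toNNReal : Measure ℝ≥0).prod (v t.toNNReal : Measure ℝ≥0)) ∧
    HasDerivAt (fun s : ℝ => ∫ k : ℝ≥0, φ k ∂(v s.toNNReal : Measure ℝ≥0))
      (1 / 2 * ∫ p : ℝ≥0 × ℝ≥0, rate β m Φ p.1 p.2 * (φ p.1 - φ p.2)
        ∂((v t.toNNReal : Measure ℝ≥0).prod (v t.toNNReal : Measure ℝ≥0))) t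

/-- The weak solutions provided by the existence theory for data with `X_η(v₀) < ∞`: they
conserve the mass and do not increase the exponential moment. -/
structure IsAdmissibleSolution (β m η : ℝ) (Φ : ℝ≥0 → ℝ≥0 → ℝ)
    (v₀ : FiniteMeasure ℝ≥0) (v : C(ℝ≥0, FiniteMeasure ℝ≥0)) : Prop
    extends IsWeakSolution β m Φ v₀ v where
  mass_eq : ∀ t, (v t).mass = v₀.mass
  expMoment_le : ∀ t, expMoment η (v t) ≤ expMoment η v₀

/-! ### The blocks of a measure -/

/-- The lower boundary curve `γ₁` of `D`: the least `y` with `(x, y) ∈ D`. -/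
def lowerEdge (θ δ : ℝ) (x : ℝ≥0) : ℝ≥0 := sInf {y | (x, y) ∈ interactionRegion θ δ}

/-- The union of the bounded gaps `I` of the closed set `K ⊆ [0, ∞)` (bounded connected components
of its complement) whose endpoints `a = inf I`, `b = sup I` satisfy `a ≤ γ₁(b)`, i.e. do not see
each other. -/
def wideGaps (θ δ : ℝ) (K : Set ℝ≥0) : Set ℝ≥0 :=
  ⋃₀ {I | (∃ x ∈ Kᶜ, I = connectedComponentIn Kᶜ x) ∧ BddAbove I ∧
    sInf I ≤ lowerEdge θ δ (sSup I)}

/-- The collection `{A_n(v)}`: the traces on `supp v` of the connected components of the complement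
of the wide gaps of `supp v`. -/
def blocks (θ δ : ℝ) (v : FiniteMeasure ℝ≥0) : Set (Set ℝ≥0) :=
  {A | ∃ x ∈ (wideGaps θ δ (v : Measure ℝ≥0).support)ᶜ,
    A = connectedComponentIn (wideGaps θ δ (v : Measure ℝ≥0).support)ᶜ x ∩
      (v : Measure ℝ≥0).support}

/-! ### Long time limit -/

/-- The time translate `t ↦ v(t + s)`. -/
def shift (s : ℝ≥0) (v : C(ℝ≥0, FiniteMeasure ℝ≥0)) : C(ℝ≥0, FiniteMeasure ℝ≥0) :=
  v.comp (ContinuousMap.addRight s)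

end

end Compton

/-!
The rate `R` is antisymmetric and nonnegative for `k ≤ k'`, so `∫ φ dv(t)` is nonincreasing in `t`
for every nondecreasing `φ`: mass only moves towards the origin. Hence the tails of `v(t)` stay
tight, and since integrals of monotone steps determine a measure of given mass, the compactness of
tight sets yields a limit `μ`. If two points of `supp μ` interacted, the integral of a step between
them would decrease at a rate bounded away from zero forever; so `Φ` vanishes between distinct
points of `supp μ`, and as `Φ = 1` near the diagonal, `supp μ` is discrete away from the origin and
`μ` is purely atomic. Nothing interacts across a wide gap of `supp v₀`, so the mass on either side
of it is conserved in time and in the limit. For the minimum `k > 0` of a block, the mass below `k`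
is therefore conserved, while the mass on `[0, z]` never decreases for `z > k`, so `k` is charged.
-/

namespace Compton

/-! ### Differential inequalities -/

lemma sub_le_of_ae_deriv_le {g : ℝ → ℝ} {s t c : ℝ} (hst : s ≤ t)
    (hg : AbsolutelyContinuousOnInterval g s t)
    (hd : ∀ᵐ x : ℝ, x ∈ Ioc s t → deriv g x ≤ c) : g t - g s ≤ c * (t - s) := by
  rw [← hg.integral_deriv_eq_sub, intervalIntegral.integral_of_le hst]
  have hint := (intervalIntegrable_iff_integrableOn_Ioc_of_le hst).1 hg.intervalIntegrable_deriv
  calc ∫ x in Ioc s t, deriv g x ≤ ∫ _ in Ioc s t, c :=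
        setIntegral_mono_on_ae hint (by simp) measurableSet_Ioc hd
    _ = c * (t - s) := by simp [hst, mul_comm]

lemma le_mul_exp_of_ae_deriv_le_mul {g : ℝ → ℝ} {s t K : ℝ} (hst : s ≤ t)
    (hg : AbsolutelyContinuousOnInterval g s t)
    (hd : ∀ᵐ x : ℝ, x ∈ Ioc s t → DifferentiableAt ℝ g x ∧ deriv g x ≤ K * g x) :
    g t ≤ g s * Real.exp (K * (t - s)) := by
  have hexp : AbsolutelyContinuousOnInterval (fun x => Real.exp (-(K * x))) s t :=
    ContDiffOn.absolutelyContinuousOnInterval (by fun_prop)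
  have hle := sub_le_of_ae_deriv_le (c := 0) hst (hexp.fun_mul hg) (by
    filter_upwards [hd] with x hx hmem
    obtain ⟨hdiff, hle⟩ := hx hmem
    have he : HasDerivAt (fun x => Real.exp (-(K * x))) (Real.exp (-(K * x)) * -(K * 1)) x :=
      ((hasDerivAt_id x).const_mul K).neg.exp
    rw [(he.fun_mul hdiff.hasDerivAt).deriv]
    linarith [mul_le_mul_of_nonneg_left hle (Real.exp_pos (-(K * x))).le])
  have hle' : g t * Real.exp (-(K * t)) ≤ g s * Real.exp (-(K * s)) := by linarith
  calc g t = g t * Real.exp (-(K * t)) * Real.exp (K * t) := by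
        rw [mul_assoc, ← Real.exp_add, neg_add_cancel, Real.exp_zero, mul_one]
    _ ≤ g s * Real.exp (-(K * s)) * Real.exp (K * t) := by gcongr
    _ = g s * Real.exp (K * (t - s)) := by
        rw [mul_assoc, ← Real.exp_add]
        ring_nf

/-! ### Compactness and narrow convergence -/

lemma exists_tendsto_of_isCompact_of_separating {ι κ X : Type*} [TopologicalSpace X]
    {Y : κ → Type*} [∀ j, TopologicalSpace (Y j)] [∀ j, T2Space (Y j)] {l : Filter ι} [l.NeBot]
    {s : Set X} (hs : IsCompact s) {u : ι → X} (hu : ∀ᶠ i in l, u i ∈ s) (g : ∀ j, X → Y j)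
    (hg : ∀ j, Continuous (g j)) (hsep : ∀ x ∈ s, ∀ y ∈ s, (∀ j, g j x = g j y) → x = y)
    (hlim : ∀ j, ∃ y, Tendsto (fun i => g j (u i)) l (𝓝 y)) :
    ∃ x ∈ s, Tendsto u l (𝓝 x) := by
  obtain ⟨x, hxs, hx⟩ := hs.exists_clusterPt (f := map u l) (le_principal_iff.2 hu)
  refine ⟨x, hxs, hs.le_nhds_of_unique_clusterPt hu fun y hys hy => hsep y hys x hxs fun j => ?_⟩
  obtain ⟨c, hc⟩ := hlim j
  have eq_lim : ∀ z, MapClusterPt z l u → g j z = c := fun z hz =>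
    eq_of_nhds_neBot <| NeBot.mono (hz.continuousAt_comp (hg j).continuousAt)
      (inf_le_inf_left _ hc)
  rw [eq_lim y hy, eq_lim x hx]

lemma exists_pos_eventually_le_measure_of_tendsto {ι Ω : Type*} [MeasurableSpace Ω]
    [TopologicalSpace Ω] [OpensMeasurableSpace Ω] [HasOuterApproxClosed Ω] {l : Filter ι}
    {ν : ι → FiniteMeasure Ω} {μ : FiniteMeasure Ω} (h : Tendsto ν l (𝓝 μ)) {U : Set Ω}
    (hU : IsOpen U) (hpos : (μ : Measure Ω) U ≠ 0) :
    ∃ ε : ℝ, 0 < ε ∧ ∀ᶠ i in l, ε ≤ (ν i : Measure Ω).real U := by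
  have hlt : (μ : Measure Ω).real Uᶜ < (μ : Measure Ω).real univ := by
    rw [← measureReal_add_measureReal_compl hU.measurableSet]
    exact lt_add_of_pos_left _ (ENNReal.toReal_pos hpos (measure_ne_top _ _))
  obtain ⟨a, ha, ham⟩ := exists_between hlt
  obtain ⟨b, hab, hbm⟩ := exists_between ham
  have : 0 ≤ a := measureReal_nonneg.trans ha.le
  have hcompl : ∀ᶠ i in l, (ν i : Measure Ω) Uᶜ < ENNReal.ofReal a :=
    eventually_lt_of_limsup_lt <|
      (FiniteMeasure.limsup_measure_closed_le_of_tendsto h hU.isClosed_compl).trans_lt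
        ((ENNReal.lt_ofReal_iff_toReal_lt (measure_ne_top _ _)).2 ha)
  have hmass : ∀ᶠ i in l, b < ((ν i).mass : ℝ) :=
    (NNReal.tendsto_coe.2 (FiniteMeasure.continuous_mass.continuousAt.tendsto.comp h)).eventually
      (lt_mem_nhds hbm)
  refine ⟨b - a, sub_pos.2 hab, ?_⟩
  filter_upwards [hcompl, hmass] with i hi hi'
  have hi := (ENNReal.lt_ofReal_iff_toReal_lt (measure_ne_top _ _)).1 hi
  have hsum := measureReal_add_measureReal_compl (μ := (ν i : Measure Ω)) hU.measurableSet
  change (ν i : Measure Ω).real Uᶜ < a at hi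
  change b < (ν i : Measure Ω).real univ at hi'
  linarith

lemma measure_eq_zero_of_tendsto {ι Ω : Type*} [MeasurableSpace Ω]
    [TopologicalSpace Ω] [OpensMeasurableSpace Ω] [HasOuterApproxClosed Ω] {l : Filter ι} [l.NeBot]
    {ν : ι → FiniteMeasure Ω} {μ : FiniteMeasure Ω} (h : Tendsto ν l (𝓝 μ)) {U : Set Ω}
    (hU : IsOpen U) (h0 : ∀ᶠ i in l, (ν i : Measure Ω) U = 0) : (μ : Measure Ω) U = 0 := by
  by_contra hpos
  obtain ⟨ε, hε, hev⟩ := exists_pos_eventually_le_measure_of_tendsto h hU hpos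
  obtain ⟨i, hi, hi0⟩ := (hev.and h0).exists
  rw [measureReal_def, hi0, ENNReal.toReal_zero] at hi
  exact hε.not_ge hi

/-! ### Atoms -/

/-- The locations of the Dirac masses of a measure. -/
def atoms {α : Type*} [MeasurableSpace α] (μ : Measure α) : Set α := {k | μ {k} ≠ 0}

section Atoms

variable {α : Type*} [MeasurableSpace α] {μ : Measure α} {S : Set α}

lemma eq_sum_smul_dirac_of_countable [MeasurableSingletonClass α] (hS : S.Countable)
    (h : μ Sᶜ = 0) : μ = Measure.sum fun k : S => μ {(k : α)} • Measure.dirac (k : α) := by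
  have := hS.to_subtype
  have hrestr := Measure.restrict_iUnion (μ := μ) (s := fun k : S => {(k : α)})
    (fun k l hkl => by simpa [Function.onFun, Subtype.ext_iff] using hkl)
    (fun k => measurableSet_singleton _)
  rw [iUnion_of_singleton_coe, Measure.restrict_eq_self_of_ae_mem (mem_ae_iff.2 h)] at hrestr
  simpa only [Measure.restrict_singleton] using hrestr

lemma tsum_measure_singleton_eq [MeasurableSingletonClass α] (hS : S.Countable) (h : μ Sᶜ = 0)
    (A : Set α) : ∑' k : {k : α // k ∈ S ∧ k ∈ A}, μ {(k : α)} = μ A := by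
  calc ∑' k : ↑(S ∩ A), μ {(k : α)} = μ (⋃ k ∈ S ∩ A, {k}) :=
        (measure_biUnion (hS.mono inter_subset_left) (fun k _ l _ hkl => disjoint_singleton.2 hkl)
          fun k _ => measurableSet_singleton k).symm
    _ = μ A := by rw [biUnion_of_singleton, inter_comm, measure_inter_conull h]

variable [TopologicalSpace α]

lemma atoms_subset_support [HereditarilyLindelofSpace α] : atoms μ ⊆ μ.support := fun _ hk =>
  not_not.1 fun hks =>
    hk (measure_mono_null (singleton_subset_iff.2 hks) Measure.measure_compl_support)

lemma measure_compl_atoms_eq_zero [HereditarilyLindelofSpace α] (h : μ.support.Countable) :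
    μ (atoms μ)ᶜ = 0 := by
  have hdiff : μ (μ.support \ atoms μ) = 0 := by
    rw [← biUnion_of_singleton (μ.support \ atoms μ),
      measure_biUnion_null_iff (h.mono sdiff_subset)]
    exact fun k hk => not_not.1 hk.2
  refine measure_mono_null (fun k hk => ?_) (measure_union_null hdiff
    (Measure.measure_compl_support (μ := μ)))
  exact (em (k ∈ μ.support)).imp (fun hks => ⟨hks, hk⟩) id

lemma mem_atoms_of_isolated [HereditarilyLindelofSpace α] {k : α} (hk : k ∈ μ.support)
    (h : ∀ᶠ y in 𝓝 k, y ∈ μ.support → y = k) : k ∈ atoms μ := by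
  intro hzero
  refine ((Measure.mem_support_iff_forall k).1 hk _ h).ne' <| measure_mono_null (fun y hy => ?_)
    (measure_union_null hzero (Measure.measure_compl_support (μ := μ)))
  exact (em (y ∈ μ.support)).imp hy id

end Atoms

lemma countable_of_isolated {X : Type*} [TopologicalSpace X] [HereditarilyLindelofSpace X]
    {s t : Set X} (ht : t.Countable) (h : ∀ x ∈ s \ t, ∀ᶠ y in 𝓝 x, y ∈ s → y = x) :
    s.Countable := by
  refine Countable.of_sdiff (t := t) ?_ ht
  refine (HereditarilyLindelofSpace.isLindelof _).countable_of_isDiscrete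
    (isDiscrete_iff_nhdsWithin.2 fun x hx => ?_)
  refine le_antisymm (le_pure_iff.2 ?_) (pure_le_nhdsWithin hx)
  filter_upwards [nhdsWithin_le_nhds (h x hx), self_mem_nhdsWithin] with y hy hys using hy hys.1

/-! ### Connected components in linear orders -/

lemma connectedComponentIn_eq_ordConnectedComponent {α : Type*}
    [ConditionallyCompleteLinearOrder α] [DenselyOrdered α] [TopologicalSpace α] [OrderTopology α]
    (s : Set α) (x : α) : connectedComponentIn s x = ordConnectedComponent s x := by
  by_cases hx : x ∈ s
  · refine Subset.antisymm (fun y hy => ?_) fun y hy => ?_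
    · exact (isPreconnected_connectedComponentIn.ordConnected.uIcc_subset
        (mem_connectedComponentIn hx) hy).trans (connectedComponentIn_subset s x)
    · exact isPreconnected_uIcc.subset_connectedComponentIn left_mem_uIcc hy right_mem_uIcc
  · rw [connectedComponentIn_eq_empty hx, ordConnectedComponent_eq_empty.2 hx]

lemma compl_ordConnectedComponent_compl {α : Type*} [LinearOrder α] {W : Set α} {x : α}
    (hx : x ∉ W) : (ordConnectedComponent Wᶜ x)ᶜ =
      (⋃ p ∈ W ∩ Iio x, Iic p) ∪ ⋃ p ∈ W ∩ Ioi x, Ici p := by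
  ext y
  simp only [mem_compl_iff, mem_ordConnectedComponent, not_subset, not_notMem, mem_union,
    mem_iUnion, mem_Iic, mem_Ici, exists_prop, mem_inter_iff, mem_Iio, mem_Ioi, mem_uIcc]
  constructor
  · rintro ⟨p, hp | hp, hpW⟩
    · exact Or.inr ⟨p, ⟨hpW, hp.1.lt_of_ne fun h => hx (h ▸ hpW)⟩, hp.2⟩
    · exact Or.inl ⟨p, ⟨hpW, hp.2.lt_of_ne fun h => hx (h ▸ hpW)⟩, hp.1⟩
  · rintro (⟨p, ⟨hpW, hpx⟩, hyp⟩ | ⟨p, ⟨hpW, hxp⟩, hpy⟩)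
    · exact ⟨p, Or.inr ⟨hyp, hpx.le⟩, hpW⟩
    · exact ⟨p, Or.inl ⟨hxp.le, hpy⟩, hpW⟩

lemma measure_biUnion_eq_iSup_of_isCompact {ι α : Type*} [TopologicalSpace α] [MeasurableSpace α]
    {μ : Measure α} [IsFiniteMeasure μ] [μ.InnerRegularCompactLTTop] {T : Set ι} {s : ι → Set α}
    (hs : MeasurableSet (⋃ i ∈ T, s i))
    (h : ∀ F ⊆ ⋃ i ∈ T, s i, IsCompact F → F.Nonempty → ∃ i ∈ T, F ⊆ s i) :
    μ (⋃ i ∈ T, s i) = ⨆ i ∈ T, μ (s i) := by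
  refine le_antisymm ?_ (iSup₂_le fun i hi => measure_mono (subset_biUnion_of_mem hi))
  rw [hs.measure_eq_iSup_isCompact_of_ne_top (measure_ne_top _ _)]
  refine iSup₂_le fun F hF => iSup_le fun hFc => ?_
  rcases F.eq_empty_or_nonempty with rfl | hne
  · simp
  obtain ⟨i, hiT, hFi⟩ := h F hF hFc hne
  exact (measure_mono hFi).trans (le_iSup₂ (f := fun i _ => μ (s i)) i hiT)

section HalfLines

variable {α : Type*} [LinearOrder α] [TopologicalSpace α] [OrderClosedTopology α]
  [MeasurableSpace α] [OpensMeasurableSpace α]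

lemma measurableSet_biUnion_Iic (T : Set α) : MeasurableSet (⋃ p ∈ T, Iic p) :=
  (isLowerSet_iUnion₂ fun p _ => isLowerSet_Iic p).ordConnected.measurableSet

lemma measurableSet_biUnion_Ici (T : Set α) : MeasurableSet (⋃ p ∈ T, Ici p) :=
  (isUpperSet_iUnion₂ fun p _ => isUpperSet_Ici p).ordConnected.measurableSet

variable (μ : Measure α) [IsFiniteMeasure μ] [μ.InnerRegularCompactLTTop]

lemma measure_biUnion_Iic (T : Set α) : μ (⋃ p ∈ T, Iic p) = ⨆ p ∈ T, μ (Iic p) :=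
  measure_biUnion_eq_iSup_of_isCompact (measurableSet_biUnion_Iic T) fun F hF hFc hne => by
    obtain ⟨y, hyF, hy⟩ := hFc.exists_isGreatest hne
    obtain ⟨p, hpT, hyp⟩ := mem_iUnion₂.1 (hF hyF)
    exact ⟨p, hpT, fun z hz => (hy hz).trans hyp⟩

lemma measure_biUnion_Ici (T : Set α) : μ (⋃ p ∈ T, Ici p) = ⨆ p ∈ T, μ (Ici p) :=
  measure_biUnion_eq_iSup_of_isCompact (measurableSet_biUnion_Ici T) fun F hF hFc hne => by
    obtain ⟨y, hyF, hy⟩ := hFc.exists_isLeast hne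
    obtain ⟨p, hpT, hpy⟩ := mem_iUnion₂.1 (hF hyF)
    exact ⟨p, hpT, fun z hz => le_trans hpy (hy hz)⟩

end HalfLines

section Comparison

variable {α : Type*} [ConditionallyCompleteLinearOrder α] [DenselyOrdered α] [TopologicalSpace α]
  [OrderTopology α] [MeasurableSpace α] [OpensMeasurableSpace α] {μ ν : Measure α}
  [IsFiniteMeasure μ] [IsFiniteMeasure ν] [μ.InnerRegularCompactLTTop]
  [ν.InnerRegularCompactLTTop] {W : Set α}

lemma measure_connectedComponentIn_compl_eq (huniv : μ univ = ν univ)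
    (hIic : ∀ p ∈ W, μ (Iic p) = ν (Iic p)) (hIci : ∀ p ∈ W, μ (Ici p) = ν (Ici p)) {x : α}
    (hx : x ∉ W) : μ (connectedComponentIn Wᶜ x) = ν (connectedComponentIn Wᶜ x) := by
  set L := ⋃ p ∈ W ∩ Iio x, Iic p
  set U := ⋃ p ∈ W ∩ Ioi x, Ici p
  have hL : μ L = ν L := by
    simp only [L, measure_biUnion_Iic]
    exact iSup_congr fun p => iSup_congr fun hp => hIic p hp.1
  have hU : μ U = ν U := by
    simp only [U, measure_biUnion_Ici]
    exact iSup_congr fun p => iSup_congr fun hp => hIci p hp.1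
  have hLmeas : MeasurableSet L := measurableSet_biUnion_Iic _
  have hUmeas : MeasurableSet U := measurableSet_biUnion_Ici _
  have hdisj : Disjoint L U := by
    simp only [L, U, disjoint_iUnion_left, disjoint_iUnion_right]
    exact fun q hq p hp => Iic_disjoint_Ici.2 (hp.2.trans hq.2).not_ge
  rw [connectedComponentIn_eq_ordConnectedComponent, ← compl_compl (ordConnectedComponent Wᶜ x),
    compl_ordConnectedComponent_compl hx, measure_compl (hLmeas.union hUmeas) (measure_ne_top _ _),
    measure_compl (hLmeas.union hUmeas) (measure_ne_top _ _), measure_union hdisj hUmeas,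
    measure_union hdisj hUmeas, hL, hU, huniv]

lemma measure_Iio_eq_of_disjoint_connectedComponentIn (hIic : ∀ p ∈ W, μ (Iic p) = ν (Iic p))
    {K : Set α} (hμ : μ Kᶜ = 0) (hν : ν Kᶜ = 0) {x : α} (hx : x ∉ W)
    (h : ∀ y ∈ K, y < x → y ∉ connectedComponentIn Wᶜ x) : μ (Iio x) = ν (Iio x) := by
  have hsub : ⋃ p ∈ W ∩ Iio x, Iic p ⊆ Iio x := iUnion₂_subset fun p hp y hy =>
    lt_of_le_of_lt hy hp.2
  have hsub' : Iio x ⊆ (⋃ p ∈ W ∩ Iio x, Iic p) ∪ Kᶜ := fun y hy => by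
    by_cases hyK : y ∈ K
    · have hy' := h y hyK hy
      rw [connectedComponentIn_eq_ordConnectedComponent, ← mem_compl_iff,
        compl_ordConnectedComponent_compl hx] at hy'
      refine Or.inl (hy'.resolve_right fun hyU => ?_)
      obtain ⟨p, hp, hpy⟩ := mem_iUnion₂.1 hyU
      exact (hp.2.trans_le hpy).not_gt hy
    · exact Or.inr hyK
  have key : ∀ ρ : Measure α, ρ Kᶜ = 0 → ρ (Iio x) = ρ (⋃ p ∈ W ∩ Iio x, Iic p) := fun ρ hρ =>
    le_antisymm ((measure_mono hsub').trans ((measure_union_le _ _).trans (by rw [hρ, add_zero])))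
      (measure_mono hsub)
  rw [key μ hμ, key ν hν, measure_biUnion_Iic, measure_biUnion_Iic]
  exact iSup_congr fun p => iSup_congr fun hp => hIic p hp.1

end Comparison

lemma mem_support_of_measure_Iio_eq {α : Type*} [LinearOrder α] [DenselyOrdered α] [NoMaxOrder α]
    [TopologicalSpace α] [OrderTopology α] [HereditarilyLindelofSpace α] [MeasurableSpace α]
    [OpensMeasurableSpace α] {μ ν : Measure α} [IsFiniteMeasure ν] {k : α}
    (hIio : μ (Iio k) = ν (Iio k))
    (hIic : ∀ z, k < z → ν (Iic z) ≤ μ (Iic z)) (hk : k ∈ ν.support)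
    (hgap : ∀ᶠ y in 𝓝[<] k, y ∉ ν.support) : k ∈ μ.support := by
  refine (Measure.mem_support_iff_forall k).2 fun U hU => ?_
  obtain ⟨z, hkz, hzU⟩ := (mem_nhdsGE_iff_exists_Icc_subset (a := k)).1
    (mem_nhdsWithin_of_mem_nhds hU)
  have hle : ν (Icc k z) ≤ μ (Icc k z) := by
    have hdisj : Disjoint (Iio k) (Icc k z) :=
      disjoint_left.2 fun y hy hy' => (not_lt.2 hy'.1) hy
    have h := hIic z hkz
    rwa [← Iio_union_Icc_eq_Iic (le_of_lt hkz), measure_union hdisj measurableSet_Icc,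
      measure_union hdisj measurableSet_Icc, hIio,
      ENNReal.add_le_add_iff_left (measure_ne_top _ _)] at h
  have hnhds : Icc k z ∪ ν.supportᶜ ∈ 𝓝 k := by
    rw [← nhdsLT_sup_nhdsGE, mem_sup]
    exact ⟨mem_of_superset hgap subset_union_right,
      mem_of_superset (Icc_mem_nhdsGE hkz) subset_union_left⟩
  calc 0 < ν (Icc k z ∪ ν.supportᶜ) := (Measure.mem_support_iff_forall k).1 hk _ hnhds
    _ ≤ ν (Icc k z) + ν ν.supportᶜ := measure_union_le _ _
    _ = ν (Icc k z) := by rw [Measure.measure_compl_support, add_zero]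
    _ ≤ μ (Icc k z) := hle
    _ ≤ μ U := measure_mono hzU

/-! ### Test functions -/

lemma IsTest.continuous_comp_coe {φ : ℝ → ℝ} (hφ : IsTest φ) :
    Continuous fun k : ℝ≥0 => φ k :=
  hφ.contDiffOn.continuousOn.comp_continuous NNReal.continuous_coe fun k => k.2

/-- A test function as a bounded continuous function on `[0, ∞)`. -/
noncomputable def IsTest.toBCF {φ : ℝ → ℝ} (hφ : IsTest φ) : BoundedContinuousFunction ℝ≥0 ℝ :=
  BoundedContinuousFunction.ofNormedAddCommGroup (fun k : ℝ≥0 => φ k) hφ.continuous_comp_coe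
    hφ.bounded.choose fun k => hφ.bounded.choose_spec k k.2

lemma IsTest.integrable {φ : ℝ → ℝ} (hφ : IsTest φ) (ν : Measure ℝ≥0) [IsFiniteMeasure ν] :
    Integrable (fun k : ℝ≥0 => φ k) ν :=
  hφ.toBCF.integrable ν

lemma IsTest.neg {φ : ℝ → ℝ} (hφ : IsTest φ) : IsTest fun x => -φ x where
  contDiffOn := hφ.contDiffOn.neg
  bounded := by simpa only [abs_neg] using hφ.bounded
  deriv_bounded := by simpa only [derivWithin.fun_neg, abs_neg] using hφ.deriv_bounded
  deriv_zero := by rw [derivWithin.fun_neg, hφ.deriv_zero, neg_zero]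

lemma isTest_of_contDiff {φ : ℝ → ℝ} (hφ : ContDiff ℝ 1 φ) (h0 : ∀ x ≤ 0, φ x = φ 0) {N : ℝ}
    (hN : ∀ x, N ≤ x → φ x = φ N) : IsTest φ := by
  have hdw : ∀ x ∈ Ici (0 : ℝ), derivWithin φ (Ici 0) x = deriv φ x := fun x hx =>
    (hφ.differentiable one_ne_zero x).derivWithin (uniqueDiffOn_Ici 0 x hx)
  refine ⟨hφ.contDiffOn, ?_, ?_, ?_⟩
  · obtain ⟨C, hC⟩ := isCompact_Icc.exists_bound_of_continuousOn
      (hφ.continuous.continuousOn (s := Icc 0 (max N 0)))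
    refine ⟨C, fun x hx => ?_⟩
    rcases le_total x (max N 0) with h | h
    · exact hC x ⟨hx, h⟩
    · rw [hN x ((le_max_left _ _).trans h), ← hN (max N 0) (le_max_left _ _)]
      exact hC _ ⟨le_max_right _ _, le_rfl⟩
  · obtain ⟨C, hC⟩ := isCompact_Icc.exists_bound_of_continuousOn
      ((hφ.continuous_deriv le_rfl).continuousOn (s := Icc 0 N))
    refine ⟨max C 0, fun x hx => ?_⟩
    rw [hdw x hx]
    rcases le_or_gt x N with h | h
    · exact (hC x ⟨hx, h⟩).trans (le_max_left _ _)
    · have hconst : φ =ᶠ[𝓝 x] fun _ => φ N := by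
        filter_upwards [lt_mem_nhds h] with y hy using hN y hy.le
      simp [hconst.deriv_eq]
  · rw [hdw 0 self_mem_Ici,
      ← (hφ.differentiable one_ne_zero 0).derivWithin (uniqueDiffOn_Iic 0 0 self_mem_Iic),
      derivWithin_congr (f := fun _ => φ 0) (s := Iic 0) h0 rfl, derivWithin_fun_const]
    rfl

lemma isTest_const (c : ℝ) : IsTest fun _ => c :=
  isTest_of_contDiff contDiff_const (fun _ _ => rfl) (N := 0) fun _ _ => rfl

lemma exists_isTest_support_eq_Ioo {a b : ℝ} (ha : 0 ≤ a) :
    ∃ φ : ℝ → ℝ, IsTest φ ∧ (∀ x, 0 ≤ φ x) ∧ Function.support φ = Ioo a b := by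
  obtain ⟨φ, hsupp, hφ, hrange⟩ :=
    (isOpen_Ioo (a := a) (b := b)).exists_contDiff_support_eq (n := 1)
  have hzero : ∀ x, x ∉ Ioo a b → φ x = 0 := fun x hx =>
    Function.notMem_support.1 (hsupp ▸ hx)
  refine ⟨φ, isTest_of_contDiff hφ (fun x hx => ?_) (N := b) (fun x hx => ?_),
    fun x => (hrange ⟨x, rfl⟩).1, hsupp⟩
  · rw [hzero x fun h => (hx.trans ha).not_gt h.1, hzero 0 fun h => ha.not_gt h.1]
  · rw [hzero x fun h => hx.not_gt h.2, hzero b fun h => h.2.false]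

/-- A smooth monotone approximation of the indicator function of a half-line: it vanishes on
`(-∞, a]` and equals `1` on `[b, ∞)`. -/
noncomputable def step (a b x : ℝ) : ℝ := Real.smoothTransition ((x - a) / (b - a))

lemma step_nonneg (a b x : ℝ) : 0 ≤ step a b x := Real.smoothTransition.nonneg _

lemma step_le_one (a b x : ℝ) : step a b x ≤ 1 := Real.smoothTransition.le_one _

section Step

variable {a b x : ℝ}

lemma step_eq_zero (hab : a < b) (hx : x ≤ a) : step a b x = 0 :=
  Real.smoothTransition.zero_of_nonpos
    (div_nonpos_of_nonpos_of_nonneg (sub_nonpos.2 hx) (sub_nonneg.2 hab.le))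

lemma step_eq_one (hab : a < b) (hx : b ≤ x) : step a b x = 1 :=
  Real.smoothTransition.one_of_one_le ((one_le_div (sub_pos.2 hab)).2 (by linarith))

lemma step_monotone (hab : a < b) : Monotone (step a b) := fun _ _ hxy =>
  Real.smoothTransition.monotone
    (div_le_div_of_nonneg_right (sub_le_sub_right hxy a) (sub_nonneg.2 hab.le))

lemma isTest_step (ha : 0 ≤ a) (hab : a < b) : IsTest (step a b) :=
  isTest_of_contDiff ((Real.smoothTransition.contDiff (n := 1)).comp (by fun_prop))
    (fun x hx => by rw [step_eq_zero hab (hx.trans ha), step_eq_zero hab ha]) (N := b)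
    (fun x hx => by rw [step_eq_one hab hx, step_eq_one hab le_rfl])

end Step

lemma tendsto_integral_step (ν : Measure ℝ≥0) [IsFiniteMeasure ν] (x : ℝ≥0) :
    Tendsto (fun b : ℝ => ∫ k : ℝ≥0, step x b k ∂ν) (𝓝[>] x) (𝓝 (ν.real (Ioi x))) := by
  rw [← integral_indicator_one measurableSet_Ioi]
  refine tendsto_integral_filter_of_dominated_convergence (fun _ => 1) ?_ ?_
    (integrable_const _) (Eventually.of_forall fun k => ?_)
  · filter_upwards [self_mem_nhdsWithin] with b hb using
      ((isTest_step x.coe_nonneg hb).integrable ν).aestronglyMeasurable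
  · refine Eventually.of_forall fun b => Eventually.of_forall fun k => ?_
    rw [Real.norm_of_nonneg (step_nonneg _ _ _)]
    exact step_le_one _ _ _
  · refine tendsto_const_nhds.congr' ?_
    rcases le_or_gt k x with h | h
    · filter_upwards [self_mem_nhdsWithin] with b hb
      rw [indicator_of_notMem (notMem_Ioi.2 h), step_eq_zero hb (NNReal.coe_le_coe.2 h)]
    · filter_upwards [Ioc_mem_nhdsGT (NNReal.coe_lt_coe.2 h)] with b hb
      rw [indicator_of_mem (mem_Ioi.2 h), step_eq_one hb.1 hb.2, Pi.one_apply]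

lemma measure_Ioi_le_of_integral_step_le {μ ν : Measure ℝ≥0} [IsFiniteMeasure μ]
    [IsFiniteMeasure ν] {x : ℝ≥0}
    (h : ∀ b : ℝ, x < b → ∫ k : ℝ≥0, step x b k ∂μ ≤ ∫ k : ℝ≥0, step x b k ∂ν) :
    μ (Ioi x) ≤ ν (Ioi x) :=
  (ENNReal.toReal_le_toReal (measure_ne_top _ _) (measure_ne_top _ _)).1 <|
    le_of_tendsto_of_tendsto (tendsto_integral_step μ x) (tendsto_integral_step ν x)
      (eventually_nhdsWithin_of_forall h)

lemma measure_Ioi_eq_of_integral_step_eq {μ ν : Measure ℝ≥0} [IsFiniteMeasure μ]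
    [IsFiniteMeasure ν] {x : ℝ≥0}
    (h : ∀ b : ℝ, x < b → ∫ k : ℝ≥0, step x b k ∂μ = ∫ k : ℝ≥0, step x b k ∂ν) :
    μ (Ioi x) = ν (Ioi x) :=
  le_antisymm (measure_Ioi_le_of_integral_step_le fun b hb => (h b hb).le)
    (measure_Ioi_le_of_integral_step_le fun b hb => (h b hb).ge)

lemma eq_of_integral_step_eq {μ ν : FiniteMeasure ℝ≥0} (hmass : μ.mass = ν.mass)
    (h : ∀ a b : ℝ, 0 ≤ a → a < b →
      ∫ k : ℝ≥0, step a b k ∂(μ : Measure ℝ≥0) = ∫ k : ℝ≥0, step a b k ∂(ν : Measure ℝ≥0)) :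
    μ = ν := by
  refine FiniteMeasure.toMeasure_injective (Measure.ext_of_Iic _ _ fun x => ?_)
  rw [← compl_Ioi, measure_compl measurableSet_Ioi (measure_ne_top _ _),
    measure_compl measurableSet_Ioi (measure_ne_top _ _),
    measure_Ioi_eq_of_integral_step_eq fun b => h x b x.coe_nonneg, ← FiniteMeasure.ennreal_mass,
    ← FiniteMeasure.ennreal_mass, hmass]

/-! ### Flows of pairwise interacting measures -/

/-- The rate of change of `∫ φ dν` caused by pair interactions with kernel `R`. -/
noncomputable def flux (R : ℝ≥0 → ℝ≥0 → ℝ) (φ : ℝ → ℝ) (ν : Measure ℝ≥0) : ℝ :=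
  1 / 2 * ∫ p : ℝ≥0 × ℝ≥0, R p.1 p.2 * (φ p.1 - φ p.2) ∂(ν.prod ν)

/-- Weak solutions of `∂v/∂t (t, k) = v(t, k) ∫ R(k, k') v(t, k') dk'` for an arbitrary interaction
kernel `R`; the encoding is that of `IsWeakSolution`. -/
structure IsWeakFlow (R : ℝ≥0 → ℝ≥0 → ℝ) (v : C(ℝ≥0, FiniteMeasure ℝ≥0)) : Prop where
  lipschitz : ∀ φ : ℝ → ℝ, IsTest φ → ∀ T : ℝ≥0, ∃ L : ℝ≥0,
    LipschitzOnWith L (fun t : ℝ≥0 => ∫ k : ℝ≥0, φ k ∂(v t : Measure ℝ≥0)) (Iic T)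
  weak : ∀ φ : ℝ → ℝ, IsTest φ → ∀ᵐ t : ℝ ∂(volume.restrict (Ioi 0)),
    Integrable (fun p : ℝ≥0 × ℝ≥0 => R p.1 p.2 * (φ p.1 - φ p.2))
      ((v t.toNNReal : Measure ℝ≥0).prod (v t.toNNReal : Measure ℝ≥0)) ∧
    HasDerivAt (fun s : ℝ => ∫ k : ℝ≥0, φ k ∂(v s.toNNReal : Measure ℝ≥0))
      (flux R φ (v t.toNNReal)) t

/-- Kernels which transport mass from higher to lower energies, leave the origin alone, and are
bounded away from it. -/
structure IsCoolingKernel (R : ℝ≥0 → ℝ≥0 → ℝ) : Prop where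
  antisymm : ∀ k k', R k k' = -R k' k
  nonneg : ∀ k k', k ≤ k' → 0 ≤ R k k'
  zero_left : ∀ k, R 0 k = 0
  exists_abs_le : ∀ ε, 0 < ε → ∃ C, ∀ k k', ε ≤ k → |R k k'| ≤ C

section Flux

variable {R : ℝ≥0 → ℝ≥0 → ℝ} {φ : ℝ → ℝ} {ν : Measure ℝ≥0}

lemma flux_neg : flux R (fun x => -φ x) ν = -flux R φ ν := by
  simp only [flux, ← mul_neg, ← integral_neg]
  congr! 4
  ring

lemma flux_eq_zero_of_forall_mem {K : Set ℝ≥0} (hν : ν Kᶜ = 0)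
    (h : ∀ k ∈ K, ∀ k' ∈ K, R k k' * (φ k - φ k') = 0) : flux R φ ν = 0 := by
  have hK : ∀ᵐ k ∂ν, k ∈ K := hν
  rw [flux, integral_eq_zero_of_ae, mul_zero]
  filter_upwards [Measure.quasiMeasurePreserving_fst.ae hK,
    Measure.quasiMeasurePreserving_snd.ae hK] with p h₁ h₂ using h _ h₁ _ h₂

lemma IsCoolingKernel.mul_sub_nonpos (hR : IsCoolingKernel R) (hφ : Monotone φ) (k k' : ℝ≥0) :
    R k k' * (φ k - φ k') ≤ 0 := by
  rcases le_total k k' with h | h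
  · exact mul_nonpos_of_nonneg_of_nonpos (hR.nonneg _ _ h) (sub_nonpos.2 (hφ h))
  · rw [hR.antisymm]
    exact mul_nonpos_of_nonpos_of_nonneg (neg_nonpos.2 (hR.nonneg _ _ h)) (sub_nonneg.2 (hφ h))

lemma IsCoolingKernel.flux_nonpos_of_monotone (hR : IsCoolingKernel R) (hφ : Monotone φ) :
    flux R φ ν ≤ 0 :=
  mul_nonpos_of_nonneg_of_nonpos one_half_pos.le
    (integral_nonpos fun p => hR.mul_sub_nonpos hφ p.1 p.2)

lemma IsTest.flux_le [IsFiniteMeasure ν] (hφ : IsTest φ) {C : ℝ}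
    (hint : Integrable (fun p : ℝ≥0 × ℝ≥0 => R p.1 p.2 * (φ p.1 - φ p.2)) (ν.prod ν))
    (hC : ∀ k k' : ℝ≥0, R k k' * (φ k - φ k') ≤ C * (φ k + φ k')) :
    flux R φ ν ≤ C * ν.real univ * ∫ k : ℝ≥0, φ k ∂ν := by
  have hfst : Integrable (fun p : ℝ≥0 × ℝ≥0 => φ p.1) (ν.prod ν) := (hφ.integrable ν).comp_fst ν
  have hsnd : Integrable (fun p : ℝ≥0 × ℝ≥0 => φ p.2) (ν.prod ν) := (hφ.integrable ν).comp_snd ν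
  calc flux R φ ν
      ≤ 1 / 2 * ∫ p : ℝ≥0 × ℝ≥0, C * (φ p.1 + φ p.2) ∂(ν.prod ν) :=
        mul_le_mul_of_nonneg_left (integral_mono hint ((hfst.add hsnd).const_mul C)
          fun p => hC p.1 p.2) one_half_pos.le
    _ = C * ν.real univ * ∫ k : ℝ≥0, φ k ∂ν := by
        rw [integral_const_mul, integral_add hfst hsnd, integral_fun_fst (fun k : ℝ≥0 => φ k),
          integral_fun_snd (fun k : ℝ≥0 => φ k), smul_eq_mul]
        ring

lemma IsCoolingKernel.exists_mul_sub_le (hR : IsCoolingKernel R) {ε : ℝ≥0} (hε : 0 < ε)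
    (hnonneg : ∀ x, 0 ≤ φ x) (hφ : ∀ k : ℝ≥0, φ k ≠ 0 → ε ≤ k) :
    ∃ C, ∀ k k' : ℝ≥0, R k k' * (φ k - φ k') ≤ C * (φ k + φ k') := by
  obtain ⟨C, hC⟩ := hR.exists_abs_le ε hε
  have hmul : ∀ k k' : ℝ≥0, |R k k'| * φ k ≤ C * φ k := fun k k' => by
    by_cases h : φ k = 0
    · simp [h]
    · exact mul_le_mul_of_nonneg_right (hC k k' (hφ k h)) (hnonneg k)
  refine ⟨C, fun k k' => ?_⟩
  calc R k k' * (φ k - φ k') = R k k' * φ k + R k' k * φ k' := by rw [hR.antisymm k' k]; ring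
    _ ≤ |R k k'| * φ k + |R k' k| * φ k' :=
        add_le_add (mul_le_mul_of_nonneg_right (le_abs_self _) (hnonneg _))
          (mul_le_mul_of_nonneg_right (le_abs_self _) (hnonneg _))
    _ ≤ C * (φ k + φ k') := by linarith [hmul k k', hmul k' k]

end Flux

section Evolution

variable {R : ℝ≥0 → ℝ≥0 → ℝ} {v : C(ℝ≥0, FiniteMeasure ℝ≥0)} {φ : ℝ → ℝ}

lemma IsWeakFlow.absolutelyContinuousOnInterval (hv : IsWeakFlow R v) (hφ : IsTest φ)
    {s t : ℝ≥0} (hst : s ≤ t) :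
    AbsolutelyContinuousOnInterval
      (fun r : ℝ => ∫ k : ℝ≥0, φ k ∂(v r.toNNReal : Measure ℝ≥0)) s t := by
  obtain ⟨L, hL⟩ := hv.lipschitz φ hφ t
  refine LipschitzOnWith.absolutelyContinuousOnInterval (K := L * 1) ?_
  rw [uIcc_of_le (NNReal.coe_le_coe.2 hst)]
  exact hL.comp (Real.lipschitzWith_toNNReal.lipschitzOnWith) fun r hr =>
    Real.toNNReal_le_iff_le_coe.2 hr.2

lemma IsWeakFlow.ae_hasDerivAt (hv : IsWeakFlow R v) (hφ : IsTest φ) (s t : ℝ≥0) :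
    ∀ᵐ r : ℝ, r ∈ Ioc (s : ℝ) t →
      Integrable (fun p : ℝ≥0 × ℝ≥0 => R p.1 p.2 * (φ p.1 - φ p.2))
        ((v r.toNNReal : Measure ℝ≥0).prod (v r.toNNReal : Measure ℝ≥0)) ∧
      HasDerivAt (fun s : ℝ => ∫ k : ℝ≥0, φ k ∂(v s.toNNReal : Measure ℝ≥0))
        (flux R φ (v r.toNNReal)) r := by
  filter_upwards [(ae_restrict_iff' measurableSet_Ioi).1 (hv.weak φ hφ)] with r hr hmem
  exact hr (s.2.trans_lt hmem.1)

lemma IsWeakFlow.integral_sub_le (hv : IsWeakFlow R v) (hφ : IsTest φ) {s t : ℝ≥0} (hst : s ≤ t)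
    {c : ℝ}
    (h : ∀ r, s ≤ r → Integrable (fun p : ℝ≥0 × ℝ≥0 => R p.1 p.2 * (φ p.1 - φ p.2))
        ((v r : Measure ℝ≥0).prod (v r : Measure ℝ≥0)) → flux R φ (v r) ≤ c) :
    ∫ k : ℝ≥0, φ k ∂(v t : Measure ℝ≥0) - ∫ k : ℝ≥0, φ k ∂(v s : Measure ℝ≥0) ≤
      c * (t - s) := by
  have hle := sub_le_of_ae_deriv_le (c := c) (NNReal.coe_le_coe.2 hst)
    (hv.absolutelyContinuousOnInterval hφ hst) (by
      filter_upwards [hv.ae_hasDerivAt hφ s t] with r hr hmem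
      obtain ⟨hint, hderiv⟩ := hr hmem
      rw [hderiv.deriv]
      exact h _ (NNReal.le_toNNReal_of_coe_le hmem.1.le) hint)
  simpa only [Real.toNNReal_coe] using hle

lemma IsWeakFlow.integral_eq_of_flux_eq_zero (hv : IsWeakFlow R v) (hφ : IsTest φ)
    (h : ∀ t, flux R φ (v t) = 0) (t : ℝ≥0) :
    ∫ k : ℝ≥0, φ k ∂(v t : Measure ℝ≥0) = ∫ k : ℝ≥0, φ k ∂(v 0 : Measure ℝ≥0) := by
  have hle := hv.integral_sub_le hφ (zero_le (a := t)) (c := 0) fun r _ _ => (h r).le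
  have hge := hv.integral_sub_le hφ.neg (zero_le (a := t)) (c := 0) fun r _ _ => by
    rw [flux_neg, h r, neg_zero]
  simp only [integral_neg] at hge
  linarith

lemma IsWeakFlow.mass_eq (hv : IsWeakFlow R v) (t : ℝ≥0) : (v t).mass = (v 0).mass := by
  have h := hv.integral_eq_of_flux_eq_zero (isTest_const 1) (fun t => by simp [flux]) t
  simp only [integral_const, smul_eq_mul, mul_one] at h
  exact NNReal.coe_injective h

lemma IsWeakFlow.integral_eq_zero (hv : IsWeakFlow R v) (hφ : IsTest φ) (hnonneg : ∀ x, 0 ≤ φ x)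
    {C : ℝ} (hC : ∀ k k' : ℝ≥0, R k k' * (φ k - φ k') ≤ C * (φ k + φ k'))
    (h0 : ∫ k : ℝ≥0, φ k ∂(v 0 : Measure ℝ≥0) = 0) (t : ℝ≥0) :
    ∫ k : ℝ≥0, φ k ∂(v t : Measure ℝ≥0) = 0 := by
  have hle := le_mul_exp_of_ae_deriv_le_mul (K := C * (v 0).mass)
    (NNReal.coe_le_coe.2 (zero_le (a := t)))
    (hv.absolutelyContinuousOnInterval hφ (zero_le (a := t))) (by
      filter_upwards [hv.ae_hasDerivAt hφ 0 t] with r hr hmem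
      obtain ⟨hint, hderiv⟩ := hr hmem
      refine ⟨hderiv.differentiableAt, ?_⟩
      rw [hderiv.deriv, ← hv.mass_eq r.toNNReal]
      exact hφ.flux_le hint hC)
  rw [Real.toNNReal_coe, NNReal.coe_zero, Real.toNNReal_zero, h0, zero_mul] at hle
  exact le_antisymm hle (integral_nonneg fun k => hnonneg k)

lemma IsWeakFlow.antitone_integral (hv : IsWeakFlow R v) (hR : IsCoolingKernel R)
    (hφ : IsTest φ) (hmono : Monotone φ) :
    Antitone fun t => ∫ k : ℝ≥0, φ k ∂(v t : Measure ℝ≥0) := fun s t hst => by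
  have hle := hv.integral_sub_le hφ hst (c := 0) fun r _ _ => hR.flux_nonpos_of_monotone hmono
  rwa [zero_mul, sub_nonpos] at hle

lemma IsWeakFlow.measure_Ioi_le (hv : IsWeakFlow R v) (hR : IsCoolingKernel R) (t x : ℝ≥0) :
    (v t : Measure ℝ≥0) (Ioi x) ≤ (v 0 : Measure ℝ≥0) (Ioi x) :=
  measure_Ioi_le_of_integral_step_le fun _ hb =>
    hv.antitone_integral hR (isTest_step x.coe_nonneg hb) (step_monotone hb) (zero_le (a := t))

end Evolution

/-! ### Conservation of mass across barriers -/

/-- The points outside `K` across which no two points of `K` interact. -/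
def barriers (R : ℝ≥0 → ℝ≥0 → ℝ) (K : Set ℝ≥0) : Set ℝ≥0 :=
  {p | p ∉ K ∧ ∀ k ∈ K, ∀ k' ∈ K, k ≤ p → p ≤ k' → R k k' = 0}

section Barriers

variable {R : ℝ≥0 → ℝ≥0 → ℝ} {v : C(ℝ≥0, FiniteMeasure ℝ≥0)} {K : Set ℝ≥0} {p : ℝ≥0}

lemma integral_step_eq_measureReal_Ioi {ν : Measure ℝ≥0} {b : ℝ≥0} (hpb : p < b) (hν : ν Kᶜ = 0)
    (hK : Icc p b ⊆ Kᶜ) : ∫ k : ℝ≥0, step p b k ∂ν = ν.real (Ioi p) := by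
  rw [← integral_indicator_one measurableSet_Ioi]
  refine integral_congr_ae ?_
  filter_upwards [measure_eq_zero_iff_ae_notMem.1 hν] with k hk
  rcases le_or_gt k p with h | h
  · rw [indicator_of_notMem (notMem_Ioi.2 h), step_eq_zero (NNReal.coe_lt_coe.2 hpb)
      (NNReal.coe_le_coe.2 h)]
  · have hbk : b ≤ k := le_of_not_ge fun hkb => hk (hK ⟨h.le, hkb⟩)
    rw [indicator_of_mem (mem_Ioi.2 h), step_eq_one (NNReal.coe_lt_coe.2 hpb)
      (NNReal.coe_le_coe.2 hbk), Pi.one_apply]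

lemma IsWeakFlow.integral_step_eq (hv : IsWeakFlow R v) (hR : IsCoolingKernel R)
    (hK : ∀ t, (v t : Measure ℝ≥0) Kᶜ = 0) (hp : p ∈ barriers R K) {b : ℝ≥0} (hpb : p < b)
    (hgap : Icc p b ⊆ Kᶜ) (t : ℝ≥0) :
    ∫ k : ℝ≥0, step p b k ∂(v t : Measure ℝ≥0) = ∫ k : ℝ≥0, step p b k ∂(v 0 : Measure ℝ≥0) := by
  have hpb' : (p : ℝ) < b := NNReal.coe_lt_coe.2 hpb
  have hlow : ∀ k ∈ K, k ≤ p → step p b k = 0 := fun k _ h =>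
    step_eq_zero hpb' (NNReal.coe_le_coe.2 h)
  have hhigh : ∀ k ∈ K, p ≤ k → step p b k = 1 := fun k hk h =>
    step_eq_one hpb' (NNReal.coe_le_coe.2 (le_of_not_ge fun hkb => hgap ⟨h, hkb⟩ hk))
  refine hv.integral_eq_of_flux_eq_zero (isTest_step p.coe_nonneg hpb')
    (fun t => flux_eq_zero_of_forall_mem (hK t) fun k hk k' hk' => ?_) t
  rcases le_total k p with h | h <;> rcases le_total k' p with h' | h'
  · rw [hlow k hk h, hlow k' hk' h', sub_self, mul_zero]
  · rw [hp.2 k hk k' hk' h h', zero_mul]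
  · rw [hR.antisymm, hp.2 k' hk' k hk h' h, neg_zero, zero_mul]
  · rw [hhigh k hk h, hhigh k' hk' h', sub_self, mul_zero]

lemma exists_Icc_subset_compl_of_mem_barriers (hK : IsClosed K) (hp : p ∈ barriers R K) :
    ∃ b, p < b ∧ Icc p b ⊆ Kᶜ :=
  mem_nhdsGE_iff_exists_Icc_subset.1
    (mem_nhdsWithin_of_mem_nhds (hK.isOpen_compl.mem_nhds hp.1))

lemma IsWeakFlow.measure_Ioi_eq_of_mem_barriers (hv : IsWeakFlow R v) (hR : IsCoolingKernel R)
    (hKc : IsClosed K) (hK : ∀ t, (v t : Measure ℝ≥0) Kᶜ = 0) (hp : p ∈ barriers R K) (t : ℝ≥0) :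
    (v t : Measure ℝ≥0) (Ioi p) = (v 0 : Measure ℝ≥0) (Ioi p) := by
  obtain ⟨b, hpb, hgap⟩ := exists_Icc_subset_compl_of_mem_barriers hKc hp
  refine (measureReal_eq_measureReal_iff).1 ?_
  rw [← integral_step_eq_measureReal_Ioi hpb (hK t) hgap,
    ← integral_step_eq_measureReal_Ioi hpb (hK 0) hgap, hv.integral_step_eq hR hK hp hpb hgap]

end Barriers

/-! ### Propagation of the support -/

section Support

variable {R : ℝ≥0 → ℝ≥0 → ℝ} {v : C(ℝ≥0, FiniteMeasure ℝ≥0)}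

lemma IsWeakFlow.measure_Ioo_eq_zero (hv : IsWeakFlow R v) (hR : IsCoolingKernel R) {a b : ℝ≥0}
    (ha : 0 < a) (h0 : (v 0 : Measure ℝ≥0) (Ioo a b) = 0) (t : ℝ≥0) :
    (v t : Measure ℝ≥0) (Ioo a b) = 0 := by
  obtain ⟨φ, hφ, hnonneg, hsupp⟩ := exists_isTest_support_eq_Ioo (b := b) a.coe_nonneg
  have hiff : ∀ ν : Measure ℝ≥0, IsFiniteMeasure ν →
      (∫ k : ℝ≥0, φ k ∂ν = 0 ↔ ν (Ioo a b) = 0) := fun ν _ => by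
    have hpos := integral_pos_iff_support_of_nonneg (μ := ν) (fun k : ℝ≥0 => hnonneg k)
      (hφ.integrable ν)
    have hset : (Function.support fun k : ℝ≥0 => φ k) = Ioo a b := by
      ext k
      exact (Set.ext_iff.1 hsupp k).trans (by simp)
    rw [hset, (integral_nonneg fun k : ℝ≥0 => hnonneg k).lt_iff_ne', pos_iff_ne_zero] at hpos
    exact not_iff_not.1 hpos
  obtain ⟨C, hC⟩ := hR.exists_mul_sub_le ha hnonneg fun k hk =>
    NNReal.coe_le_coe.1 (hsupp ▸ Function.mem_support.2 hk : (k : ℝ) ∈ Ioo (a : ℝ) b).1.le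
  exact (hiff _ inferInstance).1
    (hv.integral_eq_zero hφ hnonneg hC ((hiff _ inferInstance).2 h0) t)

lemma IsWeakFlow.measure_eq_zero_of_subset_Ioi (hv : IsWeakFlow R v) (hR : IsCoolingKernel R)
    {U : Set ℝ≥0} (hU : IsOpen U) (hU0 : U ⊆ Ioi 0) (h0 : (v 0 : Measure ℝ≥0) U = 0) (t : ℝ≥0) :
    (v t : Measure ℝ≥0) U = 0 := by
  refine measure_null_of_locally_null _ fun x hx => ?_
  obtain ⟨a, b, hab, hsub⟩ :=
    (mem_nhds_iff_exists_Ioo_subset' ⟨0, hU0 hx⟩ (exists_gt x)).1 (hU.mem_nhds hx)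
  obtain ⟨c, hac, hcx⟩ := exists_between hab.1
  exact ⟨Ioo c b, mem_nhdsWithin_of_mem_nhds (Ioo_mem_nhds hcx hab.2),
    hv.measure_Ioo_eq_zero hR (zero_le.trans_lt hac)
      (measure_mono_null ((Ioo_subset_Ioo_left hac.le).trans hsub) h0) t⟩

lemma IsWeakFlow.measure_Iio_eq_zero (hv : IsWeakFlow R v) (hR : IsCoolingKernel R) {b : ℝ≥0}
    (h0 : (v 0 : Measure ℝ≥0) (Iio b) = 0) (t : ℝ≥0) : (v t : Measure ℝ≥0) (Iio b) = 0 := by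
  rcases eq_zero_or_pos b with rfl | hb
  · simp
  obtain ⟨p, hp0, hpb⟩ := exists_between hb
  set K : Set ℝ≥0 := {0} ∪ Ici b
  have hKcompl : Kᶜ = Ioo 0 b := by
    ext k
    simp [K, pos_iff_ne_zero]
  have hKc : IsClosed K := isClosed_singleton.union isClosed_Ici
  have hK : ∀ r, (v r : Measure ℝ≥0) Kᶜ = 0 := fun r => by
    rw [hKcompl]
    exact hv.measure_eq_zero_of_subset_Ioi hR isOpen_Ioo Ioo_subset_Ioi_self
      (measure_mono_null Ioo_subset_Iio_self h0) r
  have hp : p ∈ barriers R K := by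
    refine ⟨fun h => ?_, fun k hk k' _ hkp _ => ?_⟩
    · exact (hKcompl.symm ▸ ⟨hp0, hpb⟩ : p ∈ Kᶜ) h
    · rw [hk.resolve_right fun hbk => (hpb.trans_le hbk).not_ge hkp, hR.zero_left]
  have hIic : (v t : Measure ℝ≥0) (Iic p) = 0 := by
    rw [← compl_Ioi, measure_compl measurableSet_Ioi (measure_ne_top _ _),
      hv.measure_Ioi_eq_of_mem_barriers hR hKc hK hp, ← FiniteMeasure.ennreal_mass, hv.mass_eq,
      FiniteMeasure.ennreal_mass, ← measure_compl measurableSet_Ioi (measure_ne_top _ _),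
      compl_Ioi]
    exact measure_mono_null (Iic_subset_Iio.2 hpb) h0
  refine measure_mono_null (fun k hk => ?_) (measure_union_null hIic (hK t))
  refine (le_or_gt k p).imp id fun hpk => ?_
  rw [hKcompl]
  exact ⟨hp0.trans hpk, hk⟩

lemma IsWeakFlow.measure_eq_zero (hv : IsWeakFlow R v) (hR : IsCoolingKernel R) {U : Set ℝ≥0}
    (hU : IsOpen U) (h0 : (v 0 : Measure ℝ≥0) U = 0) (t : ℝ≥0) : (v t : Measure ℝ≥0) U = 0 := by
  refine measure_null_of_locally_null _ fun x hx => ?_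
  rcases eq_zero_or_pos x with rfl | hx0
  · obtain ⟨b, hb, hsub⟩ := NNReal.nhds_zero_basis.mem_iff.1 (hU.mem_nhds hx)
    exact ⟨Iio b, mem_nhdsWithin_of_mem_nhds (Iio_mem_nhds hb),
      hv.measure_Iio_eq_zero hR (measure_mono_null hsub h0) t⟩
  · exact ⟨U ∩ Ioi 0, mem_nhdsWithin_of_mem_nhds
      ((hU.inter isOpen_Ioi).mem_nhds ⟨hx, hx0⟩), hv.measure_eq_zero_of_subset_Ioi hR
        (hU.inter isOpen_Ioi) inter_subset_right (measure_mono_null inter_subset_left h0) t⟩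

end Support

/-! ### The long time limit of a flow -/

lemma isCompact_setOf_mass_eq_and_measure_compl_Iic_le (ν : FiniteMeasure ℝ≥0) :
    IsCompact {ρ : FiniteMeasure ℝ≥0 |
      ρ.mass = ν.mass ∧ ∀ n : ℕ, ρ (Iic (n : ℝ≥0))ᶜ ≤ ν (Iic (n : ℝ≥0))ᶜ} := by
  have htail : Tendsto (fun n : ℕ => (ν : Measure ℝ≥0) (Iic (n : ℝ≥0))ᶜ) atTop (𝓝 0) := by
    have hanti : Antitone fun n : ℕ => (Iic (n : ℝ≥0))ᶜ := fun m n hmn =>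
      compl_subset_compl.2 (Iic_subset_Iic.2 (Nat.cast_le.2 hmn))
    have hempty : ⋂ n : ℕ, (Iic (n : ℝ≥0))ᶜ = ∅ := by
      rw [← compl_iUnion, compl_empty_iff, eq_univ_iff_forall]
      exact fun x => mem_iUnion.2 (exists_nat_ge x)
    have h := tendsto_measure_iInter_atTop (μ := (ν : Measure ℝ≥0))
      (fun n => measurableSet_Iic.compl.nullMeasurableSet) hanti ⟨0, measure_ne_top _ _⟩
    rwa [hempty, measure_empty] at h
  refine isCompact_setOfPred_finiteMeasure_mass_eq_compl_isCompact_le ν.mass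
    ((ENNReal.tendsto_toNNReal ENNReal.zero_ne_top).comp htail) (fun n => ?_)
    (Or.inl inferInstance)
  rw [← Icc_bot]
  exact isCompact_Icc

section Limit

variable {R : ℝ≥0 → ℝ≥0 → ℝ} {v : C(ℝ≥0, FiniteMeasure ℝ≥0)} {μ : FiniteMeasure ℝ≥0}

lemma IsTest.tendsto_integral {φ : ℝ → ℝ} (hφ : IsTest φ) (hlim : Tendsto v atTop (𝓝 μ)) :
    Tendsto (fun t => ∫ k : ℝ≥0, φ k ∂(v t : Measure ℝ≥0)) atTop
      (𝓝 (∫ k : ℝ≥0, φ k ∂(μ : Measure ℝ≥0))) :=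
  FiniteMeasure.tendsto_iff_forall_integral_tendsto.1 hlim hφ.toBCF

lemma IsWeakFlow.exists_tendsto (hv : IsWeakFlow R v) (hR : IsCoolingKernel R) :
    ∃ μ : FiniteMeasure ℝ≥0, Tendsto v atTop (𝓝 μ) := by
  have hmem : ∀ t, v t ∈ {ρ : FiniteMeasure ℝ≥0 | ρ.mass = (v 0).mass ∧
      ∀ n : ℕ, ρ (Iic (n : ℝ≥0))ᶜ ≤ (v 0) (Iic (n : ℝ≥0))ᶜ} := fun t =>
    ⟨hv.mass_eq t, fun n => by
      rw [compl_Iic]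
      exact ENNReal.toNNReal_mono (measure_ne_top _ _) (hv.measure_Ioi_le hR t n)⟩
  obtain ⟨μ, -, hμ⟩ := exists_tendsto_of_isCompact_of_separating
    (isCompact_setOf_mass_eq_and_measure_compl_Iic_le (v 0)) (Eventually.of_forall hmem)
    (fun (p : {p : ℝ × ℝ // 0 ≤ p.1 ∧ p.1 < p.2}) (ρ : FiniteMeasure ℝ≥0) =>
      ∫ k : ℝ≥0, step p.1.1 p.1.2 k ∂(ρ : Measure ℝ≥0))
    (fun p => FiniteMeasure.continuous_integral_boundedContinuousFunction
      (isTest_step p.2.1 p.2.2).toBCF)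
    (fun ρ hρ ρ' hρ' h => eq_of_integral_step_eq (hρ.1.trans hρ'.1.symm)
      fun a b ha hab => h ⟨(a, b), ha, hab⟩)
    (fun p => ⟨_, tendsto_atTop_ciInf
      (hv.antitone_integral hR (isTest_step p.2.1 p.2.2) (step_monotone p.2.2))
      ⟨0, forall_mem_range.2 fun t => integral_nonneg fun k => step_nonneg _ _ _⟩⟩)
  exact ⟨μ, hμ⟩

lemma IsWeakFlow.mass_eq_of_tendsto (hv : IsWeakFlow R v) (hlim : Tendsto v atTop (𝓝 μ)) :
    μ.mass = (v 0).mass :=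
  tendsto_nhds_unique (FiniteMeasure.continuous_mass.continuousAt.tendsto.comp hlim)
    (tendsto_const_nhds.congr fun t => (hv.mass_eq t).symm)

lemma IsWeakFlow.measure_compl_support_of_tendsto (hv : IsWeakFlow R v) (hR : IsCoolingKernel R)
    (hlim : Tendsto v atTop (𝓝 μ)) :
    (μ : Measure ℝ≥0) (v 0 : Measure ℝ≥0).supportᶜ = 0 :=
  measure_eq_zero_of_tendsto hlim Measure.isClosed_support.isOpen_compl <|
    Eventually.of_forall <| hv.measure_eq_zero hR Measure.isClosed_support.isOpen_compl
      Measure.measure_compl_support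

lemma IsWeakFlow.measure_compl_of_tendsto (hv : IsWeakFlow R v) (hlim : Tendsto v atTop (𝓝 μ))
    {A : Set ℝ≥0} (hA : MeasurableSet A) :
    (μ : Measure ℝ≥0) Aᶜ = (v 0 : Measure ℝ≥0) univ - (μ : Measure ℝ≥0) A := by
  rw [measure_compl hA (measure_ne_top _ _), ← FiniteMeasure.ennreal_mass,
    ← FiniteMeasure.ennreal_mass, hv.mass_eq_of_tendsto hlim]

lemma IsWeakFlow.measure_Iic_le_of_tendsto (hv : IsWeakFlow R v) (hR : IsCoolingKernel R)
    (hlim : Tendsto v atTop (𝓝 μ)) (x : ℝ≥0) :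
    (v 0 : Measure ℝ≥0) (Iic x) ≤ (μ : Measure ℝ≥0) (Iic x) := by
  have hIoi : (μ : Measure ℝ≥0) (Ioi x) ≤ (v 0 : Measure ℝ≥0) (Ioi x) :=
    measure_Ioi_le_of_integral_step_le fun b hb =>
      (hv.antitone_integral hR (isTest_step x.coe_nonneg hb) (step_monotone hb)).le_of_tendsto
        ((isTest_step x.coe_nonneg hb).tendsto_integral hlim) 0
  rw [← compl_Ioi, measure_compl measurableSet_Ioi (measure_ne_top _ _),
    hv.measure_compl_of_tendsto hlim measurableSet_Ioi]
  exact tsub_le_tsub_left hIoi _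

end Limit

/-! ### Points of the limiting support do not interact -/

section NonInteraction

variable {R : ℝ≥0 → ℝ≥0 → ℝ} {v : C(ℝ≥0, FiniteMeasure ℝ≥0)} {μ : FiniteMeasure ℝ≥0}

lemma IsCoolingKernel.flux_step_le (hR : IsCoolingKernel R) {ν : Measure ℝ≥0} [IsFiniteMeasure ν]
    {d e : ℝ≥0} (hde : d < e) {c : ℝ} {U V : Set ℝ≥0} (hU : MeasurableSet U)
    (hV : MeasurableSet V) (hUd : U ⊆ Iic d) (hVe : V ⊆ Ici e)
    (hc : ∀ k ∈ U, ∀ k' ∈ V, c ≤ R k k')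
    (hint : Integrable (fun p : ℝ≥0 × ℝ≥0 => R p.1 p.2 * (step d e p.1 - step d e p.2))
      (ν.prod ν)) :
    flux R (step d e) ν ≤ -(1 / 2 * (ν.real U * ν.real V * c)) := by
  have hde' : (d : ℝ) < e := NNReal.coe_lt_coe.2 hde
  have hle : ∀ p : ℝ≥0 × ℝ≥0, R p.1 p.2 * (step d e p.1 - step d e p.2) ≤
      (U ×ˢ V).indicator (fun _ => -c) p := fun p => by
    by_cases hp : p ∈ U ×ˢ V
    · rw [indicator_of_mem hp, step_eq_zero hde' (NNReal.coe_le_coe.2 (hUd hp.1)),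
        step_eq_one hde' (NNReal.coe_le_coe.2 (hVe hp.2))]
      linarith [hc _ hp.1 _ hp.2]
    · rw [indicator_of_notMem hp]
      exact hR.mul_sub_nonpos (step_monotone hde') _ _
  calc flux R (step d e) ν
      ≤ 1 / 2 * ∫ p, (U ×ˢ V).indicator (fun _ => -c) p ∂(ν.prod ν) :=
        mul_le_mul_of_nonneg_left (integral_mono hint
          ((integrable_const _).indicator (hU.prod hV)) hle) one_half_pos.le
    _ = -(1 / 2 * (ν.real U * ν.real V * c)) := by
        rw [integral_indicator_const _ (hU.prod hV), measureReal_prod_prod, smul_eq_mul]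
        ring

lemma IsWeakFlow.not_eventually_flux_le (hv : IsWeakFlow R v) {φ : ℝ → ℝ} (hφ : IsTest φ)
    (hnonneg : ∀ x, 0 ≤ φ x) {c : ℝ} (hc : 0 < c) :
    ¬ ∀ᶠ t in atTop, Integrable (fun p : ℝ≥0 × ℝ≥0 => R p.1 p.2 * (φ p.1 - φ p.2))
      ((v t : Measure ℝ≥0).prod (v t : Measure ℝ≥0)) → flux R φ (v t) ≤ -c := by
  intro h
  obtain ⟨T, hT⟩ := eventually_atTop.1 h
  set G : ℝ := ∫ k : ℝ≥0, φ k ∂(v T : Measure ℝ≥0)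
  obtain ⟨τ, hτ⟩ := exists_nat_gt (G / c)
  have hle := hv.integral_sub_le hφ (le_self_add : T ≤ T + τ) hT
  have hpos : 0 ≤ ∫ k : ℝ≥0, φ k ∂(v (T + τ) : Measure ℝ≥0) := integral_nonneg fun k => hnonneg k
  rw [NNReal.coe_add, add_sub_cancel_left, NNReal.coe_natCast] at hle
  linarith [(div_lt_iff₀ hc).1 hτ]

lemma IsWeakFlow.not_eventually_le_of_mem_support (hv : IsWeakFlow R v) (hR : IsCoolingKernel R)
    (hlim : Tendsto v atTop (𝓝 μ)) {k k' : ℝ≥0} (hk : k ∈ (μ : Measure ℝ≥0).support)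
    (hk' : k' ∈ (μ : Measure ℝ≥0).support) (hlt : k < k') {c : ℝ} (hc : 0 < c) :
    ¬ ∀ᶠ p : ℝ≥0 × ℝ≥0 in 𝓝 (k, k'), c ≤ R p.1 p.2 := by
  intro h
  obtain ⟨d, hkd, hdk'⟩ := exists_between hlt
  obtain ⟨e, hde, hek'⟩ := exists_between hdk'
  obtain ⟨U, V, hU, hkU, hV, hkV, hUV⟩ := mem_nhds_prod_iff'.1
    (h.and (prod_mem_nhds (Iio_mem_nhds hkd) (Ioi_mem_nhds hek')))
  obtain ⟨ε, hε, hεU⟩ := exists_pos_eventually_le_measure_of_tendsto hlim hU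
    ((Measure.mem_support_iff_forall k).1 hk U (hU.mem_nhds hkU)).ne'
  obtain ⟨ε', hε', hεV⟩ := exists_pos_eventually_le_measure_of_tendsto hlim hV
    ((Measure.mem_support_iff_forall k').1 hk' V (hV.mem_nhds hkV)).ne'
  refine hv.not_eventually_flux_le (isTest_step d.coe_nonneg (NNReal.coe_lt_coe.2 hde))
    (step_nonneg _ _) (by positivity : 0 < 1 / 2 * (ε * ε' * c)) ?_
  filter_upwards [hεU, hεV] with t htU htV hint
  refine (hR.flux_step_le hde hU.measurableSet hV.measurableSet
    (fun x hx => le_of_lt (show x < d from (hUV (mk_mem_prod hx hkV)).2.1))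
    (fun y hy => le_of_lt (show e < y from (hUV (mk_mem_prod hkU hy)).2.2))
    (fun x hx y hy => (hUV (mk_mem_prod hx hy)).1) hint).trans ?_
  gcongr

end NonInteraction

/-! ### The mass of the limit between barriers -/

section LimitBarriers

variable {R : ℝ≥0 → ℝ≥0 → ℝ} {v : C(ℝ≥0, FiniteMeasure ℝ≥0)} {μ : FiniteMeasure ℝ≥0} {p : ℝ≥0}

lemma IsWeakFlow.measure_Iic_eq_of_tendsto (hv : IsWeakFlow R v) (hR : IsCoolingKernel R)
    (hlim : Tendsto v atTop (𝓝 μ)) (hp : p ∈ barriers R (v 0 : Measure ℝ≥0).support) :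
    (μ : Measure ℝ≥0) (Iic p) = (v 0 : Measure ℝ≥0) (Iic p) := by
  obtain ⟨b, hpb, hgap⟩ := exists_Icc_subset_compl_of_mem_barriers Measure.isClosed_support hp
  have hcons := hv.integral_step_eq hR (hv.measure_eq_zero hR
    Measure.isClosed_support.isOpen_compl Measure.measure_compl_support) hp hpb hgap
  have hstep : ∫ k : ℝ≥0, step p b k ∂(μ : Measure ℝ≥0) =
      ∫ k : ℝ≥0, step p b k ∂(v 0 : Measure ℝ≥0) :=
    tendsto_nhds_unique
      ((isTest_step p.coe_nonneg (NNReal.coe_lt_coe.2 hpb)).tendsto_integral hlim)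
      (tendsto_const_nhds.congr fun t => (hcons t).symm)
  rw [integral_step_eq_measureReal_Ioi hpb (hv.measure_compl_support_of_tendsto hR hlim) hgap,
    integral_step_eq_measureReal_Ioi hpb Measure.measure_compl_support hgap,
    measureReal_eq_measureReal_iff] at hstep
  rw [← compl_Ioi, hv.measure_compl_of_tendsto hlim measurableSet_Ioi, hstep,
    measure_compl measurableSet_Ioi (measure_ne_top _ _)]

lemma IsWeakFlow.measure_Ici_eq_of_tendsto (hv : IsWeakFlow R v) (hR : IsCoolingKernel R)
    (hlim : Tendsto v atTop (𝓝 μ)) (hp : p ∈ barriers R (v 0 : Measure ℝ≥0).support) :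
    (μ : Measure ℝ≥0) (Ici p) = (v 0 : Measure ℝ≥0) (Ici p) := by
  have hμ : (μ : Measure ℝ≥0) {p} = 0 := measure_mono_null (singleton_subset_iff.2 hp.1)
    (hv.measure_compl_support_of_tendsto hR hlim)
  have hν : (v 0 : Measure ℝ≥0) {p} = 0 := measure_mono_null (singleton_subset_iff.2 hp.1)
    Measure.measure_compl_support
  rw [← measure_congr (Ioi_ae_eq_Ici' hμ), ← measure_congr (Ioi_ae_eq_Ici' hν), ← compl_Iic,
    hv.measure_compl_of_tendsto hlim measurableSet_Iic, hv.measure_Iic_eq_of_tendsto hR hlim hp,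
    measure_compl measurableSet_Iic (measure_ne_top _ _)]

end LimitBarriers

section LimitComponents

variable {R : ℝ≥0 → ℝ≥0 → ℝ} {v : C(ℝ≥0, FiniteMeasure ℝ≥0)} {μ : FiniteMeasure ℝ≥0}
  {W : Set ℝ≥0} {x k : ℝ≥0}

lemma IsWeakFlow.measure_connectedComponentIn_eq_of_tendsto (hv : IsWeakFlow R v)
    (hR : IsCoolingKernel R) (hlim : Tendsto v atTop (𝓝 μ))
    (hW : W ⊆ barriers R (v 0 : Measure ℝ≥0).support) (hx : x ∉ W) :
    (μ : Measure ℝ≥0) (connectedComponentIn Wᶜ x) =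
      (v 0 : Measure ℝ≥0) (connectedComponentIn Wᶜ x) :=
  measure_connectedComponentIn_compl_eq
    (by rw [← FiniteMeasure.ennreal_mass, ← FiniteMeasure.ennreal_mass,
      hv.mass_eq_of_tendsto hlim])
    (fun _ hp => hv.measure_Iic_eq_of_tendsto hR hlim (hW hp))
    (fun _ hp => hv.measure_Ici_eq_of_tendsto hR hlim (hW hp)) hx

lemma IsWeakFlow.mem_support_of_isLeast (hv : IsWeakFlow R v) (hR : IsCoolingKernel R)
    (hlim : Tendsto v atTop (𝓝 μ)) (hW : W ⊆ barriers R (v 0 : Measure ℝ≥0).support)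
    (hk : IsLeast (connectedComponentIn Wᶜ x ∩ (v 0 : Measure ℝ≥0).support) k)
    (hgap : ∀ᶠ y in 𝓝[<] k, y ∉ (v 0 : Measure ℝ≥0).support) :
    k ∈ (μ : Measure ℝ≥0).support := by
  refine mem_support_of_measure_Iio_eq ?_
    (fun z _ => hv.measure_Iic_le_of_tendsto hR hlim z) hk.1.2 hgap
  refine measure_Iio_eq_of_disjoint_connectedComponentIn
    (fun p hp => hv.measure_Iic_eq_of_tendsto hR hlim (hW hp))
    (hv.measure_compl_support_of_tendsto hR hlim) Measure.measure_compl_support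
    (connectedComponentIn_subset _ _ hk.1.1) fun y hyK hyk hy => ?_
  rw [← connectedComponentIn_eq hk.1.1] at hy
  exact (hk.2 ⟨hy, hyK⟩).not_gt hyk

end LimitComponents

/-! ### Bounds for the rate -/

section Redistribution

lemma momentumTransfer_comm (k k' c : ℝ) : momentumTransfer k k' c = momentumTransfer k' k c := by
  unfold momentumTransfer
  congr 1
  ring

lemma abs_sub_le_momentumTransfer {k k' c : ℝ} (hk : 0 ≤ k) (hk' : 0 ≤ k') (hc : c ≤ 1) :
    |k' - k| ≤ momentumTransfer k k' c := by
  refine Real.abs_le_sqrt ?_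
  nlinarith [mul_nonneg (mul_nonneg hk hk') (sub_nonneg.2 hc)]

lemma momentumTransfer_le_add {k k' c : ℝ} (hk : 0 ≤ k) (hk' : 0 ≤ k') (hc : -1 ≤ c) :
    momentumTransfer k k' c ≤ k + k' := by
  refine Real.sqrt_le_iff.2 ⟨by positivity, ?_⟩
  nlinarith [mul_nonneg (mul_nonneg hk hk') (neg_le_iff_add_nonneg.1 hc)]

lemma momentumTransfer_pos {k k' c : ℝ} (hk : 0 ≤ k) (hk' : 0 ≤ k') (hne : k ≠ k') (hc : c ≤ 1) :
    0 < momentumTransfer k k' c :=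
  (abs_pos.2 (sub_ne_zero.2 hne.symm)).trans_le (abs_sub_le_momentumTransfer hk hk' hc)

/-- The integrand of `redistribution`, with its exponent written in terms of the momentum transfer
`r = m v` instead of the velocity `v`. -/
noncomputable def angularIntegrand (β m k k' c : ℝ) : ℝ :=
  (1 + c ^ 2) / momentumTransfer k k' c *
    Real.exp (-(β * (m * ((k' - k) ^ 2 / momentumTransfer k k' c ^ 2) / 2 +
      momentumTransfer k k' c ^ 2 / (8 * m))))

variable {β m k k' c : ℝ}

lemma redistribution_eq_integral_angularIntegrand (hm : m ≠ 0) : redistribution β m k k' =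
    Real.sqrt β * Real.exp (β * (k' + k) / 2) * ∫ c in (-1)..1, angularIntegrand β m k k' c := by
  refine congrArg _ (intervalIntegral.integral_congr fun c _ => ?_)
  rcases eq_or_ne (momentumTransfer k k' c) 0 with hr | hr
  · simp only [angularIntegrand, hr, div_zero, zero_mul]
  · refine congrArg _ (congrArg _ ?_)
    field_simp
    ring

lemma redistribution_comm (β m k k' : ℝ) : redistribution β m k k' = redistribution β m k' k := by
  simp only [redistribution, momentumTransfer_comm k k', add_comm k k', sub_sq_comm k' k]

lemma redistribution_nonneg (β m k k' : ℝ) : 0 ≤ redistribution β m k k' := by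
  refine mul_nonneg (by positivity) (intervalIntegral.integral_nonneg (by norm_num) fun c _ => ?_)
  have : 0 ≤ momentumTransfer k k' c := Real.sqrt_nonneg _
  positivity

lemma angularIntegrand_le (hβ : 0 ≤ β) (hm : 0 < m) (hk : 0 ≤ k) (hk' : 0 ≤ k') (hne : k ≠ k')
    (hc : c ∈ Icc (-1 : ℝ) 1) : angularIntegrand β m k k' c ≤
      2 / |k' - k| * Real.exp (-(β * ((k' - k) ^ 2 / (8 * m)))) := by
  have hd : 0 < |k' - k| := abs_pos.2 (sub_ne_zero.2 hne.symm)
  have hr : |k' - k| ≤ momentumTransfer k k' c := abs_sub_le_momentumTransfer hk hk' hc.2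
  have hr0 := hd.trans_le hr
  have hc2 : 1 + c ^ 2 ≤ 2 := by nlinarith [hc.1, hc.2]
  have hexp : (k' - k) ^ 2 / (8 * m) ≤ m * ((k' - k) ^ 2 / momentumTransfer k k' c ^ 2) / 2 +
      momentumTransfer k k' c ^ 2 / (8 * m) := by
    refine le_add_of_nonneg_of_le (by positivity) ?_
    rw [← sq_abs (k' - k)]
    gcongr
  unfold angularIntegrand
  gcongr

lemma le_angularIntegrand (hβ : 0 ≤ β) (hm : 0 < m) (hk : 0 ≤ k) (hk' : 0 ≤ k') (hne : k ≠ k')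
    (hc : c ∈ Icc (-1 : ℝ) 1) :
    1 / (k + k') * Real.exp (-(β * (m / 2 + (k + k') ^ 2 / (8 * m)))) ≤
      angularIntegrand β m k k' c := by
  have hr : |k' - k| ≤ momentumTransfer k k' c := abs_sub_le_momentumTransfer hk hk' hc.2
  have hr' : momentumTransfer k k' c ≤ k + k' := momentumTransfer_le_add hk hk' hc.1
  have hr0 := momentumTransfer_pos hk hk' hne hc.2
  have hc2 : 1 ≤ 1 + c ^ 2 := by nlinarith [sq_nonneg c]
  have hratio : m * ((k' - k) ^ 2 / momentumTransfer k k' c ^ 2) ≤ m := by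
    refine mul_le_of_le_one_right hm.le ((div_le_one (by positivity)).2 ?_)
    rw [← sq_abs (k' - k)]
    gcongr
  unfold angularIntegrand
  gcongr

lemma continuousOn_angularIntegrand (hk : 0 ≤ k) (hk' : 0 ≤ k') (hne : k ≠ k') :
    ContinuousOn (angularIntegrand β m k k') (Icc (-1) 1) := by
  have hr : ContinuousOn (momentumTransfer k k') (Icc (-1) 1) := by
    unfold momentumTransfer
    fun_prop
  have hr0 : ∀ c ∈ Icc (-1 : ℝ) 1, momentumTransfer k k' c ≠ 0 := fun c hc =>
    (momentumTransfer_pos hk hk' hne hc.2).ne'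
  have hr2 : ∀ c ∈ Icc (-1 : ℝ) 1, momentumTransfer k k' c ^ 2 ≠ 0 := fun c hc =>
    pow_ne_zero 2 (hr0 c hc)
  unfold angularIntegrand
  fun_prop (disch := assumption)

lemma intervalIntegrable_angularIntegrand (hk : 0 ≤ k) (hk' : 0 ≤ k') (hne : k ≠ k') :
    IntervalIntegrable (angularIntegrand β m k k') volume (-1) 1 :=
  ContinuousOn.intervalIntegrable_of_Icc (by norm_num)
    (continuousOn_angularIntegrand hk hk' hne)

lemma redistribution_le (hβ : 0 ≤ β) (hm : 0 < m) (hk : 0 ≤ k) (hk' : 0 ≤ k') (hne : k ≠ k') :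
    redistribution β m k k' ≤ Real.sqrt β * Real.exp (β * (k' + k) / 2) *
      (4 / |k' - k| * Real.exp (-(β * ((k' - k) ^ 2 / (8 * m))))) := by
  rw [redistribution_eq_integral_angularIntegrand hm.ne']
  gcongr
  refine (intervalIntegral.integral_mono_on (by norm_num)
    (intervalIntegrable_angularIntegrand hk hk' hne) intervalIntegrable_const
    fun c hc => angularIntegrand_le hβ hm hk hk' hne hc).trans_eq ?_
  rw [intervalIntegral.integral_const, smul_eq_mul]
  ring

lemma le_redistribution (hβ : 0 ≤ β) (hm : 0 < m) (hk : 0 ≤ k) (hk' : 0 ≤ k') (hne : k ≠ k') :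
    Real.sqrt β * (2 / (k + k') * Real.exp (-(β * (m / 2 + (k + k') ^ 2 / (8 * m))))) ≤
      redistribution β m k k' := by
  rw [redistribution_eq_integral_angularIntegrand hm.ne']
  have hint := intervalIntegral.integral_mono_on (by norm_num) intervalIntegrable_const
    (intervalIntegrable_angularIntegrand hk hk' hne)
    fun c hc => le_angularIntegrand hβ hm hk hk' hne hc
  refine mul_le_mul (le_mul_of_one_le_right (Real.sqrt_nonneg β)
    (Real.one_le_exp (by positivity))) (le_of_eq_of_le ?_ hint) (by positivity) (by positivity)
  rw [intervalIntegral.integral_const, smul_eq_mul]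
  ring

lemma exists_pos_eventually_le_redistribution (hβ : 0 < β) (hm : 0 < m) {k k' : ℝ≥0}
    (hk : 0 < k) (hne : k ≠ k') :
    ∃ c > 0, ∀ᶠ p : ℝ≥0 × ℝ≥0 in 𝓝 (k, k'), c ≤ redistribution β m p.1 p.2 := by
  have : (0 : ℝ) < k := hk
  have hcont : ContinuousAt (fun p : ℝ≥0 × ℝ≥0 => Real.sqrt β * (2 / ((p.1 : ℝ) + p.2) *
      Real.exp (-(β * (m / 2 + ((p.1 : ℝ) + p.2) ^ 2 / (8 * m)))))) (k, k') := by
    fun_prop (disch := positivity)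
  obtain ⟨c, hc, hck⟩ := exists_between (show 0 < Real.sqrt β * (2 / ((k : ℝ) + k') *
    Real.exp (-(β * (m / 2 + ((k : ℝ) + k') ^ 2 / (8 * m))))) by positivity)
  have hne' : ∀ᶠ p : ℝ≥0 × ℝ≥0 in 𝓝 (k, k'), p.1 ≠ p.2 :=
    (isClosed_eq continuous_fst continuous_snd).isOpen_compl.mem_nhds hne
  refine ⟨c, hc, ?_⟩
  filter_upwards [hcont.eventually_const_lt hck, hne'] with p hp hpne
  exact hp.le.trans (le_redistribution hβ.le hm p.1.coe_nonneg p.2.coe_nonneg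
    (NNReal.coe_injective.ne hpne))

lemma abs_exp_neg_sub_exp_neg_mul_exp_le (x y : ℝ) :
    |Real.exp (-x) - Real.exp (-y)| * Real.exp ((y + x) / 2) ≤
      |y - x| * Real.exp (|y - x| / 2) := by
  wlog h : x ≤ y generalizing x y
  · have := this y x (le_of_not_ge h)
    rwa [abs_sub_comm, abs_sub_comm y x, add_comm y x]
  rw [abs_of_nonneg (sub_nonneg.2 (Real.exp_le_exp.2 (neg_le_neg h))),
    abs_of_nonneg (sub_nonneg.2 h)]
  calc (Real.exp (-x) - Real.exp (-y)) * Real.exp ((y + x) / 2)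
      = (1 - Real.exp (-(y - x))) * Real.exp ((y - x) / 2) := by
        rw [sub_mul, sub_mul, one_mul, ← Real.exp_add, ← Real.exp_add, ← Real.exp_add]
        ring_nf
    _ ≤ (y - x) * Real.exp ((y - x) / 2) := by
        refine mul_le_mul_of_nonneg_right ?_ (Real.exp_pos _).le
        linarith [Real.add_one_le_exp (-(y - x))]

lemma abs_exp_sub_exp_mul_redistribution_le (hβ : 0 < β) (hm : 0 < m) (hk : 0 ≤ k)
    (hk' : 0 ≤ k') : |Real.exp (-β * k) - Real.exp (-β * k')| * redistribution β m k k' ≤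
      4 * β * Real.sqrt β * Real.exp (β * m / 2) := by
  rcases eq_or_ne k k' with rfl | hne
  · rw [sub_self, abs_zero, zero_mul]
    positivity
  have : 0 < |k' - k| := abs_pos.2 (sub_ne_zero.2 hne.symm)
  have hexp := abs_exp_neg_sub_exp_neg_mul_exp_le (β * k) (β * k')
  rw [← mul_add, ← mul_sub, abs_mul, abs_of_pos hβ] at hexp
  have hsq : β * |k' - k| / 2 - β * (|k' - k| ^ 2 / (8 * m)) ≤ β * m / 2 := by
    have : β * m / 2 - (β * |k' - k| / 2 - β * (|k' - k| ^ 2 / (8 * m))) =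
        β * ((|k' - k| - 2 * m) ^ 2 / (8 * m)) := by
      field_simp
      ring
    rw [← sub_nonneg, this]
    positivity
  simp only [neg_mul]
  calc |Real.exp (-(β * k)) - Real.exp (-(β * k'))| * redistribution β m k k'
      ≤ |Real.exp (-(β * k)) - Real.exp (-(β * k'))| * (Real.sqrt β *
          Real.exp (β * (k' + k) / 2) *
            (4 / |k' - k| * Real.exp (-(β * ((k' - k) ^ 2 / (8 * m)))))) := by
        gcongr
        exact redistribution_le hβ.le hm hk hk' hne
    _ = |Real.exp (-(β * k)) - Real.exp (-(β * k'))| * Real.exp (β * (k' + k) / 2) *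
          (Real.sqrt β * (4 / |k' - k| * Real.exp (-(β * (|k' - k| ^ 2 / (8 * m)))))) := by
        rw [sq_abs]
        ring
    _ ≤ β * |k' - k| * Real.exp (β * |k' - k| / 2) *
          (Real.sqrt β * (4 / |k' - k| * Real.exp (-(β * (|k' - k| ^ 2 / (8 * m)))))) := by
        gcongr
    _ = 4 * β * Real.sqrt β *
          Real.exp (β * |k' - k| / 2 - β * (|k' - k| ^ 2 / (8 * m))) := by
        rw [sub_eq_add_neg (β * _ / 2), Real.exp_add]
        field_simp
    _ ≤ 4 * β * Real.sqrt β * Real.exp (β * m / 2) := by gcongr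

end Redistribution

section Rate

variable {β m θ δ : ℝ} {Φ : ℝ≥0 → ℝ≥0 → ℝ} {k k' : ℝ≥0}

lemma rate_zero_left (β m : ℝ) (Φ : ℝ≥0 → ℝ≥0 → ℝ) (k : ℝ≥0) : rate β m Φ 0 k = 0 := by
  simp [rate]

lemma rate_eq_zero (β m : ℝ) (h : Φ k k' = 0) : rate β m Φ k k' = 0 := by
  simp [rate, h]

lemma IsCutoff.rate_antisymm (hΦ : IsCutoff θ δ Φ) (β m : ℝ) (k k' : ℝ≥0) :
    rate β m Φ k k' = -rate β m Φ k' k := by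
  unfold rate
  rw [redistribution_comm, hΦ.symm, mul_comm (k : ℝ) k']
  ring

lemma IsCutoff.rate_nonneg (hΦ : IsCutoff θ δ Φ) (hβ : 0 ≤ β) (m : ℝ) (hk : k ≤ k') :
    0 ≤ rate β m Φ k k' := by
  have hexp : Real.exp (-β * k') ≤ Real.exp (-β * k) :=
    Real.exp_le_exp.2 (mul_le_mul_of_nonpos_left (NNReal.coe_le_coe.2 hk) (neg_nonpos.2 hβ))
  exact mul_nonneg (sub_nonneg.2 hexp) (div_nonneg
    (mul_nonneg (redistribution_nonneg _ _ _ _) (hΦ.nonneg _ _)) (by positivity))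

lemma IsCutoff.abs_rate_le (hΦ : IsCutoff θ δ Φ) (hβ : 0 < β) (hm : 0 < m) (k k' : ℝ≥0) :
    |rate β m Φ k k'| ≤ 4 * β * Real.sqrt β * Real.exp (β * m / 2) / (k * k') := by
  have hB := redistribution_nonneg β m k k'
  rw [rate, abs_mul, abs_of_nonneg (div_nonneg (mul_nonneg hB (hΦ.nonneg k k')) (by positivity)),
    ← mul_div_assoc]
  refine div_le_div_of_nonneg_right ?_ (by positivity)
  calc |Real.exp (-β * k) - Real.exp (-β * k')| * (redistribution β m k k' * Φ k k')
      ≤ |Real.exp (-β * k) - Real.exp (-β * k')| * redistribution β m k k' := by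
        gcongr
        exact mul_le_of_le_one_right hB (hΦ.le_one k k')
    _ ≤ _ := abs_exp_sub_exp_mul_redistribution_le hβ hm k.coe_nonneg k'.coe_nonneg

lemma IsCutoff.continuousAt (hΦ : IsCutoff θ δ Φ) (hk : 0 < k) :
    ContinuousAt (fun p : ℝ≥0 × ℝ≥0 => Φ p.1 p.2) (k, k') :=
  hΦ.continuousOn.continuousAt
    (isOpen_compl_singleton.mem_nhds fun h => hk.ne' (congrArg Prod.fst h))

lemma IsCutoff.exists_pos_eventually_le_rate (hΦ : IsCutoff θ δ Φ) (hβ : 0 < β) (hm : 0 < m)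
    (hk : 0 < k) (hlt : k < k') (hne : Φ k k' ≠ 0) :
    ∃ c > 0, ∀ᶠ p : ℝ≥0 × ℝ≥0 in 𝓝 (k, k'), c ≤ rate β m Φ p.1 p.2 := by
  obtain ⟨b, hb, hbB⟩ := exists_pos_eventually_le_redistribution hβ hm hk hlt.ne
  have : (0 : ℝ) < k := hk
  have hk0' : (0 : ℝ) < k' := hk.trans hlt
  have hΦpos : 0 < Φ k k' := (hΦ.nonneg _ _).lt_of_ne' hne
  have hexp : 0 < Real.exp (-β * k) - Real.exp (-β * k') := sub_pos.2 <| Real.exp_lt_exp.2 <|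
    mul_lt_mul_of_neg_left (NNReal.coe_lt_coe.2 hlt) (neg_neg_of_pos hβ)
  have hcont : ContinuousAt (fun p : ℝ≥0 × ℝ≥0 => (Real.exp (-β * p.1) - Real.exp (-β * p.2)) *
      (b * Φ p.1 p.2 / ((p.1 : ℝ) * p.2))) (k, k') := by
    have := hΦ.continuousAt (k' := k') hk
    fun_prop (disch := positivity)
  obtain ⟨c, hc, hck⟩ := exists_between (show 0 < (Real.exp (-β * k) - Real.exp (-β * k')) *
    (b * Φ k k' / ((k : ℝ) * k')) by positivity)
  refine ⟨c, hc, ?_⟩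
  filter_upwards [hcont.eventually_const_lt hck, hbB,
    (isOpen_lt continuous_fst continuous_snd).mem_nhds hlt] with p hp hpB hplt
  have hpexp : Real.exp (-β * p.2) ≤ Real.exp (-β * p.1) := Real.exp_le_exp.2 <|
    mul_le_mul_of_nonpos_left (NNReal.coe_le_coe.2 (le_of_lt hplt)) (neg_nonpos.2 hβ.le)
  refine hp.le.trans (mul_le_mul_of_nonneg_left ?_ (sub_nonneg.2 hpexp))
  have := hΦ.nonneg p.1 p.2
  gcongr

end Rate

/-! ### The interaction region -/

section Region

variable {θ δ ρ : ℝ}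

lemma rhoStar_nonneg (hθ1 : θ ≤ 1) : 0 ≤ rhoStar θ δ :=
  div_nonneg (sub_nonneg.2 hθ1) (Real.sqrt_nonneg _)

lemma sub_le_mul_sqrt_of_le {x b y : ℝ} (hρ : 0 ≤ ρ) (hy : 0 ≤ y) (hyb : y ≤ b) (hbx : b ≤ x)
    (h : x - y ≤ ρ * Real.sqrt (x * y * (x + y))) :
    b - y ≤ ρ * Real.sqrt (b * y * (b + y)) := by
  have hb : 0 ≤ b := hy.trans hyb
  rcases (hb.trans hbx).eq_or_lt with hx | hx
  · have : b - y ≤ 0 := by linarith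
    exact this.trans (by positivity)
  have hsq : (x - y) ^ 2 ≤ ρ ^ 2 * (x * y * (x + y)) := by
    rw [← Real.sq_sqrt (by positivity : 0 ≤ x * y * (x + y)), ← mul_pow]
    exact pow_le_pow_left₀ (by linarith) h 2
  have hratio : (b - y) * x * ((b - y) * (x + y)) ≤ (x - y) * b * ((x - y) * (b + y)) :=
    mul_le_mul (by nlinarith) (by nlinarith) (mul_nonneg (by linarith) (by linarith))
      (mul_nonneg (by linarith) hb)
  have hsq' : (b - y) ^ 2 ≤ ρ ^ 2 * (b * y * (b + y)) := by
    refine le_of_mul_le_mul_right ?_ (by positivity : 0 < x * (x + y))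
    calc (b - y) ^ 2 * (x * (x + y)) = (b - y) * x * ((b - y) * (x + y)) := by ring
      _ ≤ (x - y) * b * ((x - y) * (b + y)) := hratio
      _ = (x - y) ^ 2 * (b * (b + y)) := by ring
      _ ≤ ρ ^ 2 * (x * y * (x + y)) * (b * (b + y)) :=
        mul_le_mul_of_nonneg_right hsq (by positivity)
      _ = ρ ^ 2 * (b * y * (b + y)) * (x * (x + y)) := by ring
  calc b - y ≤ Real.sqrt (ρ ^ 2 * (b * y * (b + y))) := Real.le_sqrt_of_sq_le hsq'
    _ = ρ * Real.sqrt (b * y * (b + y)) := by rw [Real.sqrt_mul (sq_nonneg ρ), Real.sqrt_sq hρ]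

lemma sub_le_rhoStar_mul_sqrt {y : ℝ} (hθ : 0 < θ) (hθ1 : θ ≤ 1) (hδ : 0 < δ) (hy : θ * δ ≤ y) :
    δ - y ≤ rhoStar θ δ * Real.sqrt (δ * y * (δ + y)) := by
  have : 0 < Real.sqrt (δ * θ * (1 + θ)) := Real.sqrt_pos.2 (by positivity)
  have hsqrt : δ * Real.sqrt (δ * θ * (1 + θ)) ≤ Real.sqrt (δ * y * (δ + y)) := by
    have hy0 : 0 ≤ y := (by positivity : 0 ≤ θ * δ).trans hy
    refine Real.le_sqrt_of_sq_le ?_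
    rw [mul_pow, Real.sq_sqrt (by positivity)]
    calc δ ^ 2 * (δ * θ * (1 + θ)) = δ * (θ * δ) * (δ + θ * δ) := by ring
      _ ≤ δ * y * (δ + y) := by gcongr
  calc δ - y ≤ (1 - θ) * δ := by linarith
    _ = rhoStar θ δ * (δ * Real.sqrt (δ * θ * (1 + θ))) := by
      unfold rhoStar
      field_simp
    _ ≤ rhoStar θ δ * Real.sqrt (δ * y * (δ + y)) :=
      mul_le_mul_of_nonneg_left hsqrt (rhoStar_nonneg hθ1)

lemma mk_self_mem_region (hθ : 0 < θ) (hθ1 : θ ≤ 1) (hρ : 0 ≤ ρ) (x : ℝ≥0) :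
    (x, x) ∈ region θ δ ρ := by
  refine ⟨fun _ => ?_, fun _ => ⟨mul_le_of_le_one_left x.coe_nonneg hθ1,
    le_mul_of_one_le_left x.coe_nonneg ((one_le_inv₀ hθ).2 hθ1)⟩⟩
  rw [sub_self, abs_zero]
  positivity

lemma mk_zero_notMem_region (hθ : 0 < θ) {x : ℝ≥0} (hx : 0 < x) : (x, 0) ∉ region θ δ ρ := by
  have hx' : (0 : ℝ) < x := hx
  rintro ⟨hin, hout⟩
  by_cases h : (x : ℝ) ≤ δ ∧ ((0 : ℝ≥0) : ℝ) ≤ δ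
  · have := hin h
    simp only [NNReal.coe_zero, mul_zero, zero_mul, Real.sqrt_zero, sub_zero, NNReal.abs_eq] at this
    exact hx'.not_ge this
  · exact (mul_pos hθ hx').not_ge (hout h).1

lemma mk_mem_interactionRegion_of_le (hθ : 0 < θ) (hθ1 : θ ≤ 1) (hδ : 0 < δ) {x b y : ℝ≥0}
    (hyb : y ≤ b) (hbx : b ≤ x) (h : (x, y) ∈ interactionRegion θ δ) :
    (b, y) ∈ interactionRegion θ δ := by
  have hyb' : (y : ℝ) ≤ b := hyb
  have hbx' : (b : ℝ) ≤ x := hbx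
  have hρ : 0 ≤ rhoStar θ δ := rhoStar_nonneg hθ1
  obtain ⟨hin, hout⟩ := h
  dsimp only at hin hout
  refine ⟨fun hb => ?_, fun hb => ?_⟩ <;> dsimp only at hb ⊢
  · rw [abs_of_nonneg (sub_nonneg.2 hyb')]
    by_cases hx : (x : ℝ) ≤ δ
    · have hxy := hin ⟨hx, hb.2⟩
      rw [abs_of_nonneg (by linarith)] at hxy
      exact sub_le_mul_sqrt_of_le hρ y.coe_nonneg hyb' hbx' hxy
    · have hxy := (hout fun h => hx h.1).1
      refine sub_le_mul_sqrt_of_le hρ y.coe_nonneg hyb' hb.1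
        (sub_le_rhoStar_mul_sqrt hθ hθ1 hδ ?_)
      nlinarith
  · have hxy := hout fun h => hb ⟨hbx'.trans h.1, h.2⟩
    exact ⟨(mul_le_mul_of_nonneg_left hbx' hθ.le).trans hxy.1,
      hyb'.trans (le_mul_of_one_le_left b.coe_nonneg ((one_le_inv₀ hθ).2 hθ1))⟩

lemma lowerEdge_le {x y : ℝ≥0} (h : (x, y) ∈ interactionRegion θ δ) : lowerEdge θ δ x ≤ y :=
  csInf_le (OrderBot.bddBelow _) h

lemma nonempty_setOf_mk_mem_interactionRegion (hθ : 0 < θ) (hθ1 : θ ≤ 1) (x : ℝ≥0) :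
    {y | (x, y) ∈ interactionRegion θ δ}.Nonempty :=
  ⟨x, mk_self_mem_region hθ hθ1 (rhoStar_nonneg hθ1) x⟩

lemma lowerEdge_mono (hθ : 0 < θ) (hθ1 : θ ≤ 1) (hδ : 0 < δ) : Monotone (lowerEdge θ δ) := by
  intro b x hbx
  refine le_csInf (nonempty_setOf_mk_mem_interactionRegion hθ hθ1 x) fun y hy => ?_
  rcases le_total y b with hyb | hby
  · exact lowerEdge_le (mk_mem_interactionRegion_of_le hθ hθ1 hδ hyb hbx hy)
  · exact (lowerEdge_le (mk_self_mem_region hθ hθ1 (rhoStar_nonneg hθ1) b)).trans hby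

end Region

/-! ### The cut-off -/

section Cutoff

variable {β m θ δ : ℝ} {Φ : ℝ≥0 → ℝ≥0 → ℝ} {k k' : ℝ≥0} {K : Set ℝ≥0}

lemma IsCutoff.mem_interactionRegion (hΦ : IsCutoff θ δ Φ) (h : Φ k k' ≠ 0) :
    (k, k') ∈ interactionRegion θ δ :=
  hΦ.support_eq ▸ subset_tsupport (fun p : ℝ≥0 × ℝ≥0 => Φ p.1 p.2) h

lemma IsCutoff.apply_zero_right (hΦ : IsCutoff θ δ Φ) (hθ : 0 < θ) (hk : 0 < k) : Φ k 0 = 0 :=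
  not_not.1 fun h => mk_zero_notMem_region hθ hk (hΦ.mem_interactionRegion h)

lemma IsCutoff.apply_self (hΦ : IsCutoff θ δ Φ) (hθ : 0 < θ) (k : ℝ≥0) : Φ k k = 1 := by
  obtain ⟨θ₁, ρ₁, hθ₁, hθ₁1, hρ₁, -, hone⟩ := hΦ.eq_one
  exact hone _ (mk_self_mem_region (hθ.trans hθ₁) hθ₁1.le hρ₁.le k)

lemma IsCutoff.eventually_ne_zero (hΦ : IsCutoff θ δ Φ) (hk : 0 < k) (h : Φ k k' ≠ 0) :
    ∀ᶠ y in 𝓝 k, Φ y k' ≠ 0 :=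
  (ContinuousAt.comp (f := fun y : ℝ≥0 => (y, k')) (hΦ.continuousAt hk)
    (by fun_prop)).eventually_ne h

lemma IsCutoff.eventually_eq_of_pairwise (hΦ : IsCutoff θ δ Φ) (hθ : 0 < θ)
    (h : K.Pairwise fun x y => Φ x y = 0) (hk0 : 0 < k) (hk : k ∈ K) :
    ∀ᶠ y in 𝓝 k, y ∈ K → y = k := by
  filter_upwards [hΦ.eventually_ne_zero hk0 (hΦ.apply_self hθ k ▸ one_ne_zero)] with y hy hyK
  exact not_not.1 fun hne => hy (h hyK hk hne)

lemma IsCutoff.lowerEdge_pos (hΦ : IsCutoff θ δ Φ) (hθ : 0 < θ) (hθ1 : θ ≤ 1) {x : ℝ≥0}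
    (hx : 0 < x) : 0 < lowerEdge θ δ x := by
  have hclosed : IsClosed (interactionRegion θ δ) := hΦ.support_eq ▸ isClosed_tsupport _
  have hmem : (x, lowerEdge θ δ x) ∈ interactionRegion θ δ :=
    (hclosed.preimage (by fun_prop : Continuous fun y : ℝ≥0 => (x, y))).csInf_mem
      (nonempty_setOf_mk_mem_interactionRegion hθ hθ1 x) (OrderBot.bddBelow _)
  exact pos_iff_ne_zero.2 fun h => mk_zero_notMem_region hθ hx (h ▸ hmem)

lemma IsCutoff.lowerEdge_lt (hΦ : IsCutoff θ δ Φ) (hk : 0 < k) (h : Φ k k' ≠ 0) :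
    lowerEdge θ δ k' < k := by
  have : (𝓝[<] k).NeBot := nhdsLT_neBot_of_exists_lt ⟨0, hk⟩
  obtain ⟨y, hy, hyk⟩ := (((hΦ.eventually_ne_zero hk h).filter_mono nhdsWithin_le_nhds).and
    (self_mem_nhdsWithin (s := Iio k))).exists
  rw [hΦ.symm] at hy
  exact (lowerEdge_le (hΦ.mem_interactionRegion hy)).trans_lt hyk

lemma IsCutoff.rate_eq_zero_of_le_lowerEdge (hΦ : IsCutoff θ δ Φ) (β m : ℝ)
    (h : k ≤ lowerEdge θ δ k') : rate β m Φ k k' = 0 := by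
  rcases (zero_le (a := k)).eq_or_lt with rfl | hk
  · exact rate_zero_left β m Φ k'
  · exact rate_eq_zero β m (not_not.1 fun hne => (hΦ.lowerEdge_lt hk hne).not_ge h)

lemma IsCutoff.isCoolingKernel_rate (hΦ : IsCutoff θ δ Φ) (hβ : 0 < β) (hm : 0 < m) (hθ : 0 < θ)
    (hθ1 : θ ≤ 1) (hδ : 0 < δ) : IsCoolingKernel (rate β m Φ) where
  antisymm := hΦ.rate_antisymm β m
  nonneg _ _ hk := hΦ.rate_nonneg hβ.le m hk
  zero_left := rate_zero_left β m Φ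
  exists_abs_le ε hε := by
    have hedge : (0 : ℝ) < lowerEdge θ δ ε := hΦ.lowerEdge_pos hθ hθ1 hε
    have : (0 : ℝ) < ε := hε
    refine ⟨4 * β * Real.sqrt β * Real.exp (β * m / 2) / (ε * lowerEdge θ δ ε),
      fun k k' hk => ?_⟩
    by_cases h : Φ k k' = 0
    · rw [rate_eq_zero β m h, abs_zero]
      positivity
    · have hk' : lowerEdge θ δ ε ≤ k' :=
        (lowerEdge_mono hθ hθ1 hδ hk).trans (lowerEdge_le (hΦ.mem_interactionRegion h))
      refine (hΦ.abs_rate_le hβ hm k k').trans ?_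
      gcongr

end Cutoff

/-! ### Wide gaps and blocks -/

section Blocks

variable {β m θ δ : ℝ} {Φ : ℝ≥0 → ℝ≥0 → ℝ} {K : Set ℝ≥0} {k k' x y : ℝ≥0}

lemma wideGaps_subset_compl : wideGaps θ δ K ⊆ Kᶜ := by
  rintro p ⟨I, ⟨⟨x, -, rfl⟩, -⟩, hp⟩
  exact connectedComponentIn_subset _ _ hp

lemma le_lowerEdge_of_mem_wideGaps (hθ : 0 < θ) (hθ1 : θ ≤ 1) (hδ : 0 < δ) {p : ℝ≥0}
    (hp : p ∈ wideGaps θ δ K) (hk : k ∈ K) (hk' : k' ∈ K) (hkp : k ≤ p) (hpk' : p ≤ k') :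
    k ≤ lowerEdge θ δ k' := by
  obtain ⟨I, ⟨⟨x, -, rfl⟩, -, hI⟩, hpI⟩ := hp
  have hsub := connectedComponentIn_subset Kᶜ x
  have hord : OrdConnected (connectedComponentIn Kᶜ x) :=
    isPreconnected_connectedComponentIn.ordConnected
  have hinf : k ≤ sInf (connectedComponentIn Kᶜ x) := le_csInf ⟨p, hpI⟩ fun i hi =>
    not_lt.1 fun hik =>
      hsub (hord.out hi hpI ⟨hik.le, hkp⟩) hk
  have hsup : sSup (connectedComponentIn Kᶜ x) ≤ k' := csSup_le ⟨p, hpI⟩ fun i hi =>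
    not_lt.1 fun hik =>
      hsub (hord.out hpI hi ⟨hpk', hik.le⟩) hk'
  exact hinf.trans (hI.trans (lowerEdge_mono hθ hθ1 hδ hsup))

lemma IsCutoff.wideGaps_subset_barriers (hΦ : IsCutoff θ δ Φ) (β m : ℝ) (hθ : 0 < θ)
    (hθ1 : θ ≤ 1) (hδ : 0 < δ) : wideGaps θ δ K ⊆ barriers (rate β m Φ) K := fun _ hp =>
  ⟨wideGaps_subset_compl hp, fun _ hk _ hk' hkp hpk' => hΦ.rate_eq_zero_of_le_lowerEdge β m
    (le_lowerEdge_of_mem_wideGaps hθ hθ1 hδ hp hk hk' hkp hpk')⟩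

lemma le_lowerEdge_of_lt_isLeast (hθ : 0 < θ) (hθ1 : θ ≤ 1) (hδ : 0 < δ)
    (hk : IsLeast (connectedComponentIn (wideGaps θ δ K)ᶜ x ∩ K) k) (hy : y ∈ K) (hyk : y < k) :
    y ≤ lowerEdge θ δ k := by
  have hyC : y ∉ ordConnectedComponent (wideGaps θ δ K)ᶜ k := fun h => (hk.2 ⟨by
    rwa [connectedComponentIn_eq hk.1.1, connectedComponentIn_eq_ordConnectedComponent],
    hy⟩).not_gt hyk
  obtain ⟨p, hp, hpW⟩ := not_subset.1 hyC
  rw [uIcc_of_ge hyk.le] at hp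
  exact le_lowerEdge_of_mem_wideGaps hθ hθ1 hδ (not_not.1 hpW) hy hk.1.2 hp.1 hp.2

lemma IsCutoff.eventually_notMem_of_isLeast (hΦ : IsCutoff θ δ Φ) (hθ : 0 < θ) (hθ1 : θ ≤ 1)
    (hδ : 0 < δ) (hk : IsLeast (connectedComponentIn (wideGaps θ δ K)ᶜ x ∩ K) k) (hk0 : 0 < k) :
    ∀ᶠ y in 𝓝[<] k, y ∉ K := by
  have hlt : lowerEdge θ δ k < k := hΦ.lowerEdge_lt hk0 (hΦ.apply_self hθ k ▸ one_ne_zero)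
  filter_upwards [Ioo_mem_nhdsLT hlt] with y hy hyK
  exact (le_lowerEdge_of_lt_isLeast hθ hθ1 hδ hk hyK hy.2).not_gt hy.1

end Blocks

/-! ### The long time limit -/

section LongTime

variable {β m θ δ : ℝ} {Φ : ℝ≥0 → ℝ≥0 → ℝ} {v₀ μ : FiniteMeasure ℝ≥0}
  {v : C(ℝ≥0, FiniteMeasure ℝ≥0)}

lemma tendsto_shift (h : Tendsto v atTop (𝓝 μ)) :
    Tendsto (fun s : ℝ≥0 => shift s v) atTop (𝓝 (ContinuousMap.const ℝ≥0 μ)) := by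
  refine ContinuousMap.tendsto_nhds_compactOpen.2 fun C _ U hU hmaps => ?_
  rcases C.eq_empty_or_nonempty with rfl | ⟨x, hx⟩
  · exact Eventually.of_forall fun s => mapsTo_empty _ _
  obtain ⟨T, hT⟩ := eventually_atTop.1 (h.eventually (hU.mem_nhds (hmaps hx)))
  filter_upwards [eventually_ge_atTop T] with s hs t _
  exact hT _ (hs.trans le_add_self)

lemma IsWeakSolution.isWeakFlow (hv : IsWeakSolution β m Φ v₀ v) : IsWeakFlow (rate β m Φ) v :=
  ⟨hv.lipschitz, hv.weak⟩

lemma IsWeakFlow.pairwise_support_cutoff_eq_zero (hv : IsWeakFlow (rate β m Φ) v)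
    (hΦ : IsCutoff θ δ Φ) (hβ : 0 < β) (hm : 0 < m) (hθ : 0 < θ)
    (hR : IsCoolingKernel (rate β m Φ)) (hlim : Tendsto v atTop (𝓝 μ)) :
    (μ : Measure ℝ≥0).support.Pairwise fun k k' => Φ k k' = 0 := by
  intro k hk k' hk' hne
  wlog hlt : k < k' generalizing k k'
  · rw [hΦ.symm]
    exact this hk' hk hne.symm (hne.lt_or_gt.resolve_left hlt)
  rcases (zero_le (a := k)).eq_or_lt with rfl | hk0
  · rw [hΦ.symm]
    exact hΦ.apply_zero_right hθ hlt
  by_contra h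
  obtain ⟨c, hc, hle⟩ := hΦ.exists_pos_eventually_le_rate hβ hm hk0 hlt h
  exact hv.not_eventually_le_of_mem_support hR hlim hk hk' hlt hc hle

lemma IsWeakFlow.support_countable (hv : IsWeakFlow (rate β m Φ) v) (hΦ : IsCutoff θ δ Φ)
    (hβ : 0 < β) (hm : 0 < m) (hθ : 0 < θ) (hR : IsCoolingKernel (rate β m Φ))
    (hlim : Tendsto v atTop (𝓝 μ)) : (μ : Measure ℝ≥0).support.Countable :=
  countable_of_isolated (countable_singleton 0) fun _ hk => hΦ.eventually_eq_of_pairwise hθ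
    (hv.pairwise_support_cutoff_eq_zero hΦ hβ hm hθ hR hlim) (pos_iff_ne_zero.2 hk.2) hk.1

lemma IsWeakFlow.measure_block_eq_of_tendsto (hv : IsWeakFlow (rate β m Φ) v)
    (hΦ : IsCutoff θ δ Φ) (hθ : 0 < θ) (hθ1 : θ ≤ 1) (hδ : 0 < δ)
    (hR : IsCoolingKernel (rate β m Φ)) (hlim : Tendsto v atTop (𝓝 μ)) {A : Set ℝ≥0}
    (hA : A ∈ blocks θ δ (v 0)) : (μ : Measure ℝ≥0) A = (v 0 : Measure ℝ≥0) A := by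
  obtain ⟨x, hx, rfl⟩ := hA
  rw [measure_inter_conull (hv.measure_compl_support_of_tendsto hR hlim),
    measure_inter_conull Measure.measure_compl_support,
    hv.measure_connectedComponentIn_eq_of_tendsto hR hlim
      (hΦ.wideGaps_subset_barriers β m hθ hθ1 hδ) hx]

lemma IsWeakFlow.mem_support_of_isLeast_block (hv : IsWeakFlow (rate β m Φ) v)
    (hΦ : IsCutoff θ δ Φ) (hθ : 0 < θ) (hθ1 : θ ≤ 1) (hδ : 0 < δ)
    (hR : IsCoolingKernel (rate β m Φ)) (hlim : Tendsto v atTop (𝓝 μ)) {A : Set ℝ≥0}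
    (hA : A ∈ blocks θ δ (v 0)) {k : ℝ≥0} (hk : IsLeast A k) (hk0 : 0 < k) :
    k ∈ (μ : Measure ℝ≥0).support := by
  obtain ⟨x, -, rfl⟩ := hA
  exact hv.mem_support_of_isLeast hR hlim (hΦ.wideGaps_subset_barriers β m hθ hθ1 hδ) hk
    (hΦ.eventually_notMem_of_isLeast hθ hθ1 hδ hk hk0)

end LongTime

end Compton

open Compton in
theorem theorem1p5_general (β m θ δ : ℝ) (hβ : 0 < β) (hm : 0 < m)
    (hθ : 0 < θ) (hθ1 : θ < 1) (hδ : 0 < δ)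
    (Φ : ℝ≥0 → ℝ≥0 → ℝ) (hΦ : Compton.IsCutoff θ δ Φ) (v₀ : FiniteMeasure ℝ≥0)
    (v : C(ℝ≥0, FiniteMeasure ℝ≥0)) (hv : Compton.IsWeakSolution β m Φ v₀ v) :
    ∃ (μ : FiniteMeasure ℝ≥0) (S : Set ℝ≥0) (M : ℝ≥0 → ℝ≥0),
      S.Countable ∧ (∀ k ∈ S, 0 < M k) ∧
      (μ : Measure ℝ≥0) = Measure.sum (fun k : S => (M k : ℝ≥0∞) • Measure.dirac (k : ℝ≥0)) ∧
      Tendsto (fun s : ℝ≥0 => Compton.shift s v) atTop (𝓝 (ContinuousMap.const ℝ≥0 μ)) ∧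
      S ⊆ (v₀ : Measure ℝ≥0).support ∧
      (∀ k ∈ S, ∀ k' ∈ S, k ≠ k' → Φ k k' = 0) ∧
      (∀ A ∈ Compton.blocks θ δ v₀,
        ∑' k : {k : ℝ≥0 // k ∈ S ∧ k ∈ A}, (M k : ℝ≥0∞) = (v₀ : Measure ℝ≥0) A) ∧
      (∀ A ∈ Compton.blocks θ δ v₀, ∀ k, IsLeast A k → 0 < k → k ∈ S) := by
  obtain rfl := hv.initial
  have hflow := hv.isWeakFlow
  have hR := hΦ.isCoolingKernel_rate hβ hm hθ hθ1.le hδ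
  obtain ⟨μ, hlim⟩ := hflow.exists_tendsto hR
  have hpair := hflow.pairwise_support_cutoff_eq_zero hΦ hβ hm hθ hR hlim
  have hcount := hflow.support_countable hΦ hβ hm hθ hR hlim
  have hS := hcount.mono atoms_subset_support
  have hnull := measure_compl_atoms_eq_zero hcount
  have hM : ∀ k, (μ {k} : ℝ≥0∞) = (μ : Measure ℝ≥0) {k} := fun k =>
    FiniteMeasure.ennreal_coeFn_eq_coeFn_toMeasure μ {k}
  refine ⟨μ, atoms μ, fun k => μ {k}, hS, fun k hk => ?_, ?_, tendsto_shift hlim,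
    fun k hk => ?_, fun k hk k' hk' => hpair (atoms_subset_support hk) (atoms_subset_support hk'),
    fun A hA => ?_, fun A hA k hk hk0 => ?_⟩
  · exact ENNReal.coe_pos.1 (hM k ▸ pos_iff_ne_zero.2 hk)
  · simpa only [hM] using eq_sum_smul_dirac_of_countable hS hnull
  · exact not_not.1 fun h => hk <| measure_mono_null (singleton_subset_iff.2 h)
      (hflow.measure_compl_support_of_tendsto hR hlim)
  · simp only [hM, tsum_measure_singleton_eq hS hnull,
      hflow.measure_block_eq_of_tendsto hΦ hθ hθ1.le hδ hR hlim hA]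
  · have hks := hflow.mem_support_of_isLeast_block hΦ hθ hθ1.le hδ hR hlim hA hk hk0
    exact mem_atoms_of_isolated hks (hΦ.eventually_eq_of_pairwise hθ hpair hk0 hks)

/-- The locations `k_i'` of the Dirac masses form the countable set `S`, and the mass at `k ∈ S` is
`M k > 0`. Convergence is that of `v(s + ·)` to the constant map `μ` in `C([0, ∞), 𝓜₊([0, ∞)))`
with the compact-open topology, as `s → ∞`. -/
theorem theorem1p5 (β m θ δ η : ℝ) (hβ : 0 < β) (hm : 0 < m)
    (hθ : 0 < θ) (hθ1 : θ < 1) (hδ : 0 < δ) (hη : (1 - θ) / 2 ≤ η)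
    (Φ : ℝ≥0 → ℝ≥0 → ℝ) (hΦ : Compton.IsCutoff θ δ Φ)
    (v₀ : FiniteMeasure ℝ≥0) (hv₀ : Compton.expMoment η v₀ < ∞)
    (v : C(ℝ≥0, FiniteMeasure ℝ≥0)) (hv : Compton.IsAdmissibleSolution β m η Φ v₀ v) :
    ∃ (μ : FiniteMeasure ℝ≥0) (S : Set ℝ≥0) (M : ℝ≥0 → ℝ≥0),
      S.Countable ∧ (∀ k ∈ S, 0 < M k) ∧
      (μ : Measure ℝ≥0) = Measure.sum (fun k : S => (M k : ℝ≥0∞) • Measure.dirac (k : ℝ≥0)) ∧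
      Tendsto (fun s : ℝ≥0 => Compton.shift s v) atTop (𝓝 (ContinuousMap.const ℝ≥0 μ)) ∧
      S ⊆ (v₀ : Measure ℝ≥0).support ∧
      (∀ k ∈ S, ∀ k' ∈ S, k ≠ k' → Φ k k' = 0) ∧
      (∀ A ∈ Compton.blocks θ δ v₀,
        ∑' k : {k : ℝ≥0 // k ∈ S ∧ k ∈ A}, (M k : ℝ≥0∞) = (v₀ : Measure ℝ≥0) A) ∧
      (∀ A ∈ Compton.blocks θ δ v₀, ∀ k, IsLeast A k → 0 < k → k ∈ S) :=
  theorem1p5_general β m θ δ hβ hm hθ hθ1 hδ Φ hΦ v₀ v hv.toIsWeakSolution
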